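/- Let $ZFC^-$ denote $ZFC$ without the power set axiom, formulated with the collection scheme in place of replacement and with the well-ordering principle (every set can be well-ordered) in place of the axiom of choice. Let $\hat V$ be a model of $ZFC^-$, let $\hat\omega$ be the set of natural numbers of $\hat V$, linearly ordered by the membership relation $\hat<$ of $\hat V$, and suppose that $\hat V$ is $\omega$-nonstandard, i.e. some $\hat n\in\hat\omega$ has infinitely many predecessors. For infinite regular cardinals $\kappa,\theta$, a $(\kappa,\theta)$-cut in a linear order $(L,<)$ is a pair of sequences $(a_\alpha:\alpha<\kappa)$, $(b_\beta:\beta<\theta)$ from $L$ such that $a_\alpha<a_{\alpha'}<b_{\beta'}<b_\beta$ for all $\alpha<\alpha'<\kappa$ and $\beta<\beta'<\theta$, and such that no $c\in L$ satisfies $a_\alpha<c<b_\beta$ for all $\alpha<\kappa$, $\beta<\theta$. Let $\mathfrak p_{\hat V}$ be the least cardinal of the form $\kappa+\theta$ such that $\kappa,\theta$ are infinite regular cardinals and there is a $(\kappa,\theta)$-cut in $(\hat\omega,\hat<)$. Let $\mathfrak t_{\hat V}$ be the least cardinal $\kappa$ such that, for some nonzero $\hat n\in\hat\omega$, there is a strictly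 increasing sequence $(s_\alpha:\alpha<\kappa)$ with no upper bound in the tree $\hat n^{<\hat n}$ of all functions $s\in\hat V$ from some $\hat m\,\hat<\,\hat n$ to $\hat n$ (in the sense of $\hat V$), ordered by inclusion. Suppose $\mathfrak p_{\hat V}<\mathfrak t_{\hat V}$, let $\lambda=\mathfrak p_{\hat V}$, and let $\kappa<\lambda$ be an infinite regular cardinal. Then there is no $(\kappa,\lambda)$-cut in $(\hat\omega,\hat<)$. -/

import Mathlib

universe u

namespace SetModel

open FirstOrder.Language

/-- The only nonlogical symbol of the language of set theory: a binary relation symbol. -/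
inductive SetRel : ℕ → Type
  | mem : SetRel 2

/-- The first-order language of set theory. -/
def setLang : FirstOrder.Language.{0, 0} := ⟨fun _ => Empty, SetRel⟩

section Axioms

variable {V : Type u} [setLang.Structure V]

/-- `Mem x y`: the structure thinks that `x` is an element of `y`. -/
def Mem (x y : V) : Prop :=
  Structure.RelMap (L := setLang) SetRel.mem ![x, y]

/-- `x` is a subset of `y`, in the sense of the structure. -/
def IsSubset (x y : V) : Prop := ∀ z, Mem z x → Mem z y

/-- `x` is the empty set of the structure. -/
def IsEmptySet (x : V) : Prop := ∀ z, ¬ Mem z x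

/-- `p = {a, b}` in the structure. -/
def IsUPair (p a b : V) : Prop := ∀ z, Mem z p ↔ z = a ∨ z = b

/-- `p = (a, b) = {{a}, {a, b}}` in the structure. -/
def IsOPair (p a b : V) : Prop :=
  ∃ s t, IsUPair s a a ∧ IsUPair t a b ∧ IsUPair p s t

/-- `y = x ∪ {x}` in the structure. -/
def IsSucc (y x : V) : Prop := ∀ z, Mem z y ↔ Mem z x ∨ z = x

/-- `w` contains the empty set and is closed under `x ↦ x ∪ {x}`, in the structure. -/
def IsInductive (w : V) : Prop :=
  (∃ e, IsEmptySet e ∧ Mem e w) ∧ ∀ x, Mem x w → ∃ y, IsSucc y x ∧ Mem y w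

/-- The pair `(a, b)` belongs to the set of ordered pairs `r`. -/
def PairMem (r a b : V) : Prop := ∃ p, IsOPair p a b ∧ Mem p r

/-- In the structure, `r` is a strict well-ordering of `x`. -/
def IsWellOrderOn (r x : V) : Prop :=
  (∀ a, Mem a x → ¬ PairMem r a a) ∧
  (∀ a b c, Mem a x → Mem b x → Mem c x → PairMem r a b → PairMem r b c → PairMem r a c) ∧
  (∀ a b, Mem a x → Mem b x → PairMem r a b ∨ a = b ∨ PairMem r b a) ∧
  (∀ y, IsSubset y x → (∃ a, Mem a y) →
    ∃ a, Mem a y ∧ ∀ b, Mem b y → b ≠ a → PairMem r a b)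

/-- In the structure, `f` is a function from `m` to `n`. -/
def IsFunction (f m n : V) : Prop :=
  (∀ p, Mem p f → ∃ i v, Mem i m ∧ Mem v n ∧ IsOPair p i v) ∧
  ∀ i, Mem i m → ∃! v, PairMem f i v

variable (V)

/-- `V` is a model of `ZFC⁻`: `ZFC` without the power set axiom, with the collection scheme in
place of replacement and the well-ordering principle in place of choice. The two schemes range
over all first-order formulas with parameters from `V`. -/
structure IsModelZFCMinus : Prop where
  extensionality : ∀ x y : V, (∀ z, Mem z x ↔ Mem z y) → x = y
  foundation : ∀ x : V, (∃ y, Mem y x) → ∃ y, Mem y x ∧ ∀ z, Mem z x → ¬ Mem z y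
  pairing : ∀ a b : V, ∃ p, IsUPair p a b
  union : ∀ x : V, ∃ u, ∀ z, Mem z u ↔ ∃ y, Mem y x ∧ Mem z y
  infinity : ∃ w : V, IsInductive w
  separation : ∀ D : Set V, Set.Definable₁ Set.univ setLang D →
    ∀ x : V, ∃ y, ∀ z, Mem z y ↔ Mem z x ∧ z ∈ D
  collection : ∀ R : V → V → Prop, Set.Definable₂ Set.univ setLang {p : V × V | R p.1 p.2} →
    ∀ a : V, (∀ x, Mem x a → ∃ y, R x y) → ∃ b, ∀ x, Mem x a → ∃ y, Mem y b ∧ R x y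
  wellOrdering : ∀ x : V, ∃ r, IsWellOrderOn r x

/-- The natural numbers of `V`: the elements of `V` that `V` thinks belong to every inductive
set. -/
def OmegaHat : Type u := {n : V // ∀ w : V, IsInductive w → Mem n w}

/-- The natural numbers of `V` are ordered by the membership relation of `V`. -/
instance : LT (OmegaHat V) := ⟨fun m n => Mem m.1 n.1⟩

/-- Some natural number of `V` has infinitely many predecessors. -/
def IsOmegaNonstandard : Prop := ∃ n : OmegaHat V, {m : OmegaHat V | m < n}.Infinite

end Axioms

section Cuts

/-- A `(κ, θ)`-pre-cut: `(a_α : α < κ)` is increasing, `(b_β : β < θ)` is decreasing, and the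
former lies below the latter. -/
def IsPreCut {L : Type u} [LT L] {κ θ : Cardinal.{u}}
    (a : Set.Iio κ.ord → L) (b : Set.Iio θ.ord → L) : Prop :=
  ∀ α α' : Set.Iio κ.ord, α < α' → ∀ β β' : Set.Iio θ.ord, β < β' →
    a α < a α' ∧ a α' < b β' ∧ b β' < b β

/-- A `(κ, θ)`-cut: a pre-cut that no element fills. -/
def IsCut {L : Type u} [LT L] {κ θ : Cardinal.{u}}
    (a : Set.Iio κ.ord → L) (b : Set.Iio θ.ord → L) : Prop :=
  IsPreCut a b ∧ ¬ ∃ c : L, ∀ α β, a α < c ∧ c < b β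

/-- The cut spectrum of `L`: the pairs of infinite regular cardinals `(κ, θ)` such that `L` admits
a `(κ, θ)`-cut. -/
def cutSpectrum (L : Type u) [LT L] : Set (Cardinal.{u} × Cardinal.{u}) :=
  {p | p.1.IsRegular ∧ p.2.IsRegular ∧
    ∃ (a : Set.Iio p.1.ord → L) (b : Set.Iio p.2.ord → L), IsCut a b}

/-- The least `κ + θ` for `(κ, θ)` in the cut spectrum of `L`. -/
noncomputable def cut (L : Type u) [LT L] : Cardinal.{u} :=
  sInf {μ | ∃ p ∈ cutSpectrum L, μ = p.1 + p.2}

/-- `κ` is the least length of an increasing sequence from `T` without an upper bound in `T`. -/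
def IsTreeTops (T : Type u) [Preorder T] (κ : Cardinal.{u}) : Prop :=
  IsLeast {μ : Cardinal.{u} |
    ∃ s : Set.Iio μ.ord → T, StrictMono s ∧ ¬ BddAbove (Set.range s)} κ

end Cuts

section Invariants

variable {V : Type u} [setLang.Structure V]

/-- The tree `n^{<n}` of `V`: the functions of `V` from some `m < n` to `n`. -/
def SeqTree (n : OmegaHat V) : Type u :=
  {s : V // ∃ m : OmegaHat V, m < n ∧ IsFunction s m.1 n.1}

/-- The tree `n^{<n}` is ordered by the inclusion relation of `V`. -/
instance (n : OmegaHat V) : Preorder (SeqTree n) where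
  le s t := IsSubset s.1 t.1
  le_refl _ _ hz := hz
  le_trans _ _ _ hst htr z hz := htr z (hst z hz)

variable (V)

/-- The invariant `𝔭` of `V`. -/
noncomputable def pCard : Cardinal.{u} := cut (OmegaHat V)

/-- The invariant `𝔱` of `V`: the least value of `tree-tops(n^{<n})` over the natural numbers
`n ≠ 0` of `V` for which it exists (the set `0^{<0}` is empty, hence not a tree). -/
noncomputable def tCard : Cardinal.{u} :=
  sInf {κ | ∃ n : OmegaHat V, ¬ IsEmptySet n.1 ∧ IsTreeTops (SeqTree n) κ}

end Invariants

end SetModel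

/-!
Write `𝔭` and `𝔱` for the two invariants, and suppose that `d` (increasing, of length `κ < 𝔭`) and
`e` (decreasing, of length `𝔭`) form a cut in the natural numbers of the model.

*What the invariants provide.* Since no cut has both sides shorter than `𝔭`, two sets of fewer than
`𝔭` numbers, one below the other, can be separated (`exists_between_of_lt_pCard`), and hence fewer
than `𝔭` definable properties that hold up to all members of a short sequence still hold at a common
place beyond it (`exists_overspill`). Since `𝔭 < 𝔱`, increasing sequences of length at most `𝔭` in
the trees `n^{<n}` have upper bounds (`exists_upperBound`). Together these give `exists_path`: a
sequence of at most `𝔭` numbers, increasing for a definable transitive relation, runs through one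
function of the model, and a definable property that holds from the `i`-th term of the sequence on
holds for the values of this function between the `i`-th place and any later one. For sequences
shorter than `𝔭` a further overspill yields saturation (`Cov.saturation`): fewer than `𝔭` definable
conditions on the elements of a set that is finite in the sense of the model, any finitely many of
which can be satisfied, can be satisfied together. Power sets and products of finite sets are
finite, so saturation applies to relations and to sets of relations.

*The contradiction* (`exists_between_of_lt_tCard`). For each `γ < 𝔭` choose a function `g γ` from
the ordinal `γ` to `κ`, injective if `γ < κ⁺`. Saturation gives a relation `Y γ` of the model, a
row, with label `e γ` and with value `d (g γ β)` at `e β` for each `β < γ` (`exists_isRow`). As all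
values `d i` lie below `e j`, saturation gives for each `j < 𝔭` a set `S j` of the model that
contains `Y β` for `β ≤ j` and in which the value of any row at the label of any other row is less
than `e j` (`exists_bounded`). A path runs through the pairs `(S j, e j)`, with decreasing weights
`e j`. Along an upper bound of the path, each `Y γ` survives beyond all the places of the `(S j, e
j)`; where it last survives, the weight is below all `e j`, so it is at most some `d (c γ)` because
the cut is not filled. By the pigeonhole principle there are `γ < κ⁺` and `κ` many `β < γ` with the
same color `c β = c γ`. At the first place of weight at most `d (c γ)` all these rows are present
together, so that `d (g γ β) < d (c γ)`. Then `g γ` injects `κ` many ordinals into the ordinal `c γ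
< κ`, which is impossible.
-/

namespace SetModel

/-! ### Definability with parameters -/

section Definability

open FirstOrder FirstOrder.Language

variable {V : Type u} [setLang.Structure V]

-- Definability is organized as a type class, so that instance search proves it by recursion on the
-- shape of a predicate. A quantifier adds a last entry to the valuation, and `Fin.init` recovers
-- the valuation outside the quantifier.

/-- `Tm t`: the function `t` of a valuation is the value of a term. The language has no function
symbols, so that `t` is a variable or a parameter. -/
class Tm {n : ℕ} (t : (Fin n → V) → V) : Prop where
  out : ∃ τ : (setLang[[(Set.univ : Set V)]]).Term (Fin n), ∀ v, τ.realize v = t v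

/-- `Def P`: the predicate `P` of valuations is first-order definable with parameters. -/
class Def {n : ℕ} (P : (Fin n → V) → Prop) : Prop where
  out : Set.Definable Set.univ setLang {v | P v}

variable {n : ℕ}

instance tmConst (a : V) : Tm (fun _ : Fin n → V => a) :=
  ⟨Constants.term (setLang.con (⟨a, trivial⟩ : (Set.univ : Set V))), fun v => by simp⟩

/-- `Reindex g`: the valuation `g v` consists of some of the entries of `v`. -/
class Reindex {m n : ℕ} (g : (Fin m → V) → (Fin n → V)) : Prop where
  out : ∃ e : Fin n → Fin m, ∀ v i, g v i = v (e i)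

instance reindexId : Reindex (fun v : Fin n → V => v) := ⟨id, fun _ _ => rfl⟩

instance reindexInit {m : ℕ} (g : (Fin m → V) → (Fin (n + 1) → V)) [h : Reindex g] :
    Reindex (fun v => (Fin.init (g v) : Fin n → V)) := by
  obtain ⟨e, he⟩ := h.out
  exact ⟨fun i => e i.castSucc, fun v i => he v _⟩

-- The composition with the identity is met in this eta-reduced form.
instance reindexInitSelf :
    Reindex (Fin.init : (Fin (n + 1) → V) → (Fin n → V)) := reindexInit _

instance tmVar {m : ℕ} (g : (Fin m → V) → (Fin n → V)) [h : Reindex g] (i : Fin n) :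
    Tm (fun v => g v i) := by
  obtain ⟨e, he⟩ := h.out
  exact ⟨Term.var (e i), fun v => (he v i).symm⟩

instance tmReindex {m : ℕ} (t : (Fin n → V) → V) (g : (Fin m → V) → (Fin n → V)) [h : Tm t]
    [hg : Reindex g] : Tm (fun v => t (g v)) := by
  obtain ⟨τ, hτ⟩ := h.out
  obtain ⟨e, he⟩ := hg.out
  refine ⟨τ.relabel e, fun v => ?_⟩
  rw [Term.realize_relabel, ← hτ]
  congr 1
  funext i
  exact (he v i).symm

instance defMem (s t : (Fin n → V) → V) [hs : Tm s] [ht : Tm t] :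
    Def (fun v => Mem (s v) (t v)) := by
  obtain ⟨σ, hσ⟩ := hs.out
  obtain ⟨τ, hτ⟩ := ht.out
  refine ⟨Relations.formula₂
    ((setLang.lhomWithConstants (Set.univ : Set V)).onRelation SetRel.mem) σ τ, ?_⟩
  ext v
  change Mem (s v) (t v) ↔ Formula.Realize _ v
  rw [Formula.realize_rel₂, hσ, hτ]
  exact Iff.of_eq (LHom.map_onRelation (setLang.lhomWithConstants (Set.univ : Set V))
    (SetRel.mem : setLang.Relations 2) ![s v, t v]).symm

instance defEq (s t : (Fin n → V) → V) [hs : Tm s] [ht : Tm t] :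
    Def (fun v => s v = t v) := by
  obtain ⟨σ, hσ⟩ := hs.out
  obtain ⟨τ, hτ⟩ := ht.out
  refine ⟨σ.equal τ, ?_⟩
  ext v
  simp [hσ, hτ]

instance defNot (P : (Fin n → V) → Prop) [h : Def P] : Def (fun v => ¬ P v) := ⟨h.out.compl⟩

instance defAnd (P Q : (Fin n → V) → Prop) [hP : Def P] [hQ : Def Q] :
    Def (fun v => P v ∧ Q v) := ⟨hP.out.inter hQ.out⟩

instance defOr (P Q : (Fin n → V) → Prop) [hP : Def P] [hQ : Def Q] :
    Def (fun v => P v ∨ Q v) := ⟨hP.out.union hQ.out⟩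

instance defImp (P Q : (Fin n → V) → Prop) [hP : Def P] [hQ : Def Q] :
    Def (fun v => P v → Q v) := by
  simp only [imp_iff_not_or]; infer_instance

instance defIff (P Q : (Fin n → V) → Prop) [hP : Def P] [hQ : Def Q] :
    Def (fun v => P v ↔ Q v) := by
  simp only [iff_iff_implies_and_implies]; infer_instance

instance defExists (P : (Fin n → V) → V → Prop)
    [h : Def (fun v : Fin (n + 1) → V => P (Fin.init v) (v (Fin.last n)))] :
    Def (fun v => ∃ x, P v x) := by
  refine ⟨(congrArg _ ?_).mp (h.out.image_comp (Fin.castSucc (n := n)))⟩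
  ext v
  constructor
  · rintro ⟨w, hw, rfl⟩
    exact ⟨_, hw⟩
  · rintro ⟨x, hx⟩
    refine ⟨Fin.snoc v x, ?_, ?_⟩
    · simpa using hx
    · ext i; simp

instance defForall (P : (Fin n → V) → V → Prop)
    [h : Def (fun v : Fin (n + 1) → V => P (Fin.init v) (v (Fin.last n)))] :
    Def (fun v => ∀ x, P v x) := by
  have : Def (fun v => ¬ ∃ x, ¬ P v x) := inferInstance
  simpa using this

instance defConst (p : Prop) : Def (fun _ : Fin n → V => p) := by
  by_cases h : p
  · exact ⟨by simp [h]⟩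
  · exact ⟨by simp [h]⟩

instance defIsUPair (s t r : (Fin n → V) → V) [Tm s] [Tm t] [Tm r] :
    Def (fun v => IsUPair (s v) (t v) (r v)) := by
  unfold IsUPair; infer_instance

instance defIsOPair (s t r : (Fin n → V) → V) [Tm s] [Tm t] [Tm r] :
    Def (fun v => IsOPair (s v) (t v) (r v)) := by
  unfold IsOPair
  infer_instance

instance defPairMem (s t r : (Fin n → V) → V) [Tm s] [Tm t] [Tm r] :
    Def (fun v => PairMem (s v) (t v) (r v)) := by
  unfold PairMem; infer_instance

instance defIsEmptySet (s : (Fin n → V) → V) [Tm s] : Def (fun v => IsEmptySet (s v)) := by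
  unfold IsEmptySet; infer_instance

instance defIsSucc (s t : (Fin n → V) → V) [Tm s] [Tm t] :
    Def (fun v => IsSucc (s v) (t v)) := by
  unfold IsSucc; infer_instance

instance defIsInductive (s : (Fin n → V) → V) [Tm s] : Def (fun v => IsInductive (s v)) := by
  unfold IsInductive; infer_instance

/-- Definability with parameters of a unary predicate. -/
class Def₁ (D : V → Prop) : Prop where
  out : Def (fun v : Fin 1 → V => D (v 0))

/-- Definability with parameters of a binary predicate. -/
class Def₂ (R : V → V → Prop) : Prop where
  out : Def (fun v : Fin 2 → V => R (v 0) (v 1))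

instance def₁OfDef (D : V → Prop) [h : Def (fun v : Fin 1 → V => D (v 0))] : Def₁ D := ⟨h⟩

instance def₂OfDef (R : V → V → Prop) [h : Def (fun v : Fin 2 → V => R (v 0) (v 1))] :
    Def₂ R := ⟨h⟩

instance def₁App (D : V → Prop) (t : (Fin n → V) → V) [h : Def₁ D] [Tm t] :
    Def (fun v => D (t v)) := by
  have : Def (fun v : Fin (n + 1) → V => D (v (Fin.last n))) :=
    ⟨h.out.out.preimage_comp (fun _ => Fin.last n)⟩
  have h2 : Def (fun v => ∃ x, x = t v ∧ D x) := inferInstance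
  simpa using h2

instance def₂App (R : V → V → Prop) (s t : (Fin n → V) → V) [h : Def₂ R] [Tm s] [Tm t] :
    Def (fun v => R (s v) (t v)) := by
  have : Def (fun v : Fin (n + 2) → V =>
      R ((Fin.init v : Fin (n + 1) → V) (Fin.last n)) (v (Fin.last (n + 1)))) := by
    have := h.out.out.preimage_comp
      (![(Fin.last n).castSucc, Fin.last (n + 1)] : Fin 2 → Fin (n + 2))
    exact ⟨this⟩
  have h2 : Def (fun v => ∃ x y, x = s v ∧ y = t v ∧ R x y) := inferInstance
  simpa using h2

/-- `IsOm x`: the structure thinks that `x` is a natural number. -/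
def IsOm (x : V) : Prop := ∀ w : V, IsInductive w → Mem x w

instance defIsOm (s : (Fin n → V) → V) [Tm s] : Def (fun v => IsOm (s v)) := by
  unfold IsOm; infer_instance

end Definability

/-! ### Basic set theory in the structure -/

section Basic

variable {V : Type u} [setLang.Structure V]

theorem IsUPair.inj {p a b c d : V} (h : IsUPair p a b) (h' : IsUPair p c d) :
    (a = c ∧ b = d) ∨ (a = d ∧ b = c) := by
  have h1 := (h' a).1 ((h a).2 (Or.inl rfl))
  have h2 := (h' b).1 ((h b).2 (Or.inr rfl))
  have h3 := (h c).1 ((h' c).2 (Or.inl rfl))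
  have h4 := (h d).1 ((h' d).2 (Or.inr rfl))
  grind

theorem IsOPair.inj {p a b c d : V} (h : IsOPair p a b) (h' : IsOPair p c d) :
    a = c ∧ b = d := by
  obtain ⟨s, t, hs, ht, hp⟩ := h
  obtain ⟨s', t', hs', ht', hp'⟩ := h'
  rcases hp.inj hp' with ⟨rfl, rfl⟩ | ⟨rfl, rfl⟩
  · have h1 := hs.inj hs'
    have h2 := ht.inj ht'
    grind
  · have h1 := hs.inj ht'
    have h2 := ht.inj hs'
    grind

theorem lt_iff_mem {m n : OmegaHat V} : m < n ↔ Mem m.1 n.1 := Iff.rfl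

-- As a `Fact`, the axioms are available to the instances on `OmegaHat V` below.
variable [hV : Fact (IsModelZFCMinus V)]

theorem ext_of {x y : V} (h : ∀ z, Mem z x ↔ Mem z y) : x = y := hV.out.extensionality x y h

theorem exists_sep (x : V) (D : V → Prop) [h : Def₁ D] : ∃ y, ∀ z, Mem z y ↔ Mem z x ∧ D z :=
  hV.out.separation {z | D z} h.out.out x

theorem exists_collection (a : V) (R : V → V → Prop) [h : Def₂ R]
    (H : ∀ x, Mem x a → ∃ y, R x y) : ∃ b, ∀ x, Mem x a → ∃ y, Mem y b ∧ R x y :=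
  hV.out.collection R h.out.out a H

theorem exists_isEmptySet : ∃ e : V, IsEmptySet e := by
  obtain ⟨w, hw⟩ := hV.out.infinity
  exact hw.1.imp fun _ h => h.1

theorem exists_union (x y : V) : ∃ u, ∀ z, Mem z u ↔ Mem z x ∨ Mem z y := by
  obtain ⟨p, hp⟩ := hV.out.pairing x y
  obtain ⟨u, hu⟩ := hV.out.union p
  refine ⟨u, fun z => ?_⟩
  rw [hu]
  constructor
  · rintro ⟨q, hq, hz⟩
    rcases (hp q).1 hq with rfl | rfl <;> simp [hz]
  · rintro (h | h)
    exacts [⟨x, (hp x).2 (Or.inl rfl), h⟩, ⟨y, (hp y).2 (Or.inr rfl), h⟩]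

theorem exists_insert (x a : V) : ∃ y, ∀ z, Mem z y ↔ Mem z x ∨ z = a := by
  obtain ⟨p, hp⟩ := hV.out.pairing a a
  obtain ⟨u, hu⟩ := exists_union x p
  exact ⟨u, fun z => by rw [hu, hp, or_self]⟩

/-- The image of a set under a definable function exists. -/
theorem exists_image (a : V) (R : V → V → Prop) [h : Def₂ R]
    (H : ∀ x, Mem x a → ∃! y, R x y) : ∃ b, ∀ y, Mem y b ↔ ∃ x, Mem x a ∧ R x y := by
  obtain ⟨b, hb⟩ := exists_collection a R fun x hx => (H x hx).exists
  obtain ⟨c, hc⟩ := exists_sep b fun y => ∃ x, Mem x a ∧ R x y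
  refine ⟨c, fun y => ?_⟩
  rw [hc, and_iff_right_iff_imp]
  rintro ⟨x, hx, hxy⟩
  obtain ⟨y', hy', hxy'⟩ := hb x hx
  rwa [(H x hx).unique hxy hxy']

theorem mem_irrefl (x : V) : ¬ Mem x x := by
  intro hx
  obtain ⟨p, hp⟩ := hV.out.pairing x x
  obtain ⟨y, hy, h⟩ := hV.out.foundation p ⟨x, (hp x).2 (Or.inl rfl)⟩
  obtain rfl : y = x := by simpa using (hp y).1 hy
  exact h y hy hx

theorem exists_isOPair (a b : V) : ∃ p, IsOPair p a b := by
  obtain ⟨s, hs⟩ := hV.out.pairing a a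
  obtain ⟨t, ht⟩ := hV.out.pairing a b
  obtain ⟨p, hp⟩ := hV.out.pairing s t
  exact ⟨p, s, t, hs, ht, hp⟩

theorem IsOPair.unique {p q a b : V} (hp : IsOPair p a b) (hq : IsOPair q a b) : p = q := by
  obtain ⟨s, t, hs, ht, hp⟩ := hp
  obtain ⟨s', t', hs', ht', hq⟩ := hq
  obtain rfl : s = s' := ext_of fun z => by rw [hs, hs']
  obtain rfl : t = t' := ext_of fun z => by rw [ht, ht']
  exact ext_of fun z => by rw [hp, hq]

/-- The ordered pair of two elements of the structure. -/
noncomputable def opair (a b : V) : V := (exists_isOPair a b).choose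

theorem isOPair_opair (a b : V) : IsOPair (opair a b) a b := (exists_isOPair a b).choose_spec

theorem isOPair_iff {p a b : V} : IsOPair p a b ↔ p = opair a b :=
  ⟨fun h => h.unique (isOPair_opair a b), fun h => h ▸ isOPair_opair a b⟩

theorem opair_inj {a b c d : V} : opair a b = opair c d ↔ a = c ∧ b = d :=
  ⟨fun h => (isOPair_opair a b).inj (h ▸ isOPair_opair c d), fun h => by rw [h.1, h.2]⟩

theorem pairMem_iff {r a b : V} : PairMem r a b ↔ Mem (opair a b) r := by
  simp [PairMem, isOPair_iff]

end Basic

/-! ### The natural numbers of the structure -/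

section Omega

variable {V : Type u} [setLang.Structure V] [hV : Fact (IsModelZFCMinus V)]

theorem exists_isSucc (x : V) : ∃ y, IsSucc y x := exists_insert x x

theorem IsSucc.unique {x y z : V} (h : IsSucc y x) (h' : IsSucc z x) : y = z :=
  ext_of fun w => by rw [h, h']

theorem IsEmptySet.unique {x y : V} (h : IsEmptySet x) (h' : IsEmptySet y) : x = y :=
  ext_of fun w => by simp [h w, h' w]

theorem IsEmptySet.isOm {x : V} (h : IsEmptySet x) : IsOm x := by
  rintro w ⟨⟨e, he, hew⟩, -⟩
  rwa [h.unique he]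

theorem IsOm.succ {x y : V} (hx : IsOm x) (h : IsSucc y x) : IsOm y := by
  intro w hw
  obtain ⟨z, hz, hzw⟩ := hw.2 x (hx w hw)
  rwa [h.unique hz]

/-- Definable induction on the natural numbers of the structure. -/
theorem om_induction (D : V → Prop) [Def₁ D] (h0 : ∀ e, IsEmptySet e → D e)
    (hs : ∀ x y, IsOm x → D x → IsSucc y x → D y) {n : V} (hn : IsOm n) : D n := by
  obtain ⟨w, hw⟩ := hV.out.infinity
  obtain ⟨y, hy⟩ := exists_sep w fun z => D z ∧ IsOm z
  refine ((hy n).1 (hn y ⟨?_, ?_⟩)).2.1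
  · obtain ⟨e, he, hew⟩ := hw.1
    exact ⟨e, he, (hy e).2 ⟨hew, h0 e he, he.isOm⟩⟩
  · intro x hx
    obtain ⟨hxw, hxD, hxo⟩ := (hy x).1 hx
    obtain ⟨z, hz, hzw⟩ := hw.2 x hxw
    exact ⟨z, hz, (hy z).2 ⟨hzw, hs x z hxo hxD hz, hxo.succ hz⟩⟩

/-- The set of natural numbers of the structure. -/
theorem exists_omega : ∃ o : V, ∀ x, Mem x o ↔ IsOm x := by
  obtain ⟨w, hw⟩ := hV.out.infinity
  obtain ⟨y, hy⟩ := exists_sep w fun z => IsOm z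
  exact ⟨y, fun x => by rw [hy, and_iff_right_iff_imp]; exact fun h => h w hw⟩

theorem IsOm.mem_trans {n : V} (hn : IsOm n) : ∀ y z, Mem z y → Mem y n → Mem z n := by
  refine om_induction (fun n => ∀ y z, Mem z y → Mem y n → Mem z n) ?_ ?_ hn
  · intro e he y z _ hy
    exact absurd hy (he y)
  · intro x y _ ih hs a b hba hay
    rw [hs] at hay ⊢
    rcases hay with h | rfl
    exacts [Or.inl (ih a b hba h), Or.inl hba]

theorem IsOm.of_mem {n m : V} (hn : IsOm n) (hm : Mem m n) : IsOm m := by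
  refine om_induction (fun n => ∀ m, Mem m n → IsOm m) ?_ ?_ hn m hm
  · intro e he y hy
    exact absurd hy (he y)
  · intro x y hx ih hs m hm
    rcases (hs m).1 hm with h | rfl
    exacts [ih m h, hx]

theorem IsOm.empty_or_succ {n : V} (hn : IsOm n) :
    IsEmptySet n ∨ ∃ m, IsOm m ∧ IsSucc n m :=
  om_induction (fun n => IsEmptySet n ∨ ∃ m, IsOm m ∧ IsSucc n m) (fun _ h => Or.inl h)
    (fun x _ hx _ hs => Or.inr ⟨x, hx, hs⟩) hn

theorem IsOm.empty_mem {n e : V} (hn : IsOm n) (he : IsEmptySet e) : Mem e n ∨ e = n := by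
  refine om_induction (fun n => Mem e n ∨ e = n) (fun x hx => Or.inr (he.unique hx)) ?_ hn
  intro x y _ ih hs
  rw [hs]
  exact Or.inl ih

theorem IsOm.succ_mem {n m k : V} (hn : IsOm n) (hm : Mem m n) (hk : IsSucc k m) :
    Mem k n ∨ k = n := by
  refine om_induction (fun n => ∀ m k, Mem m n → IsSucc k m → Mem k n ∨ k = n) ?_ ?_ hn m k hm hk
  · intro e he y _ hy
    exact absurd hy (he y)
  · intro x y _ ih hs m k hm hk
    rcases (hs m).1 hm with h | rfl
    · rw [hs]
      exact Or.inl (ih m k h hk)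
    · exact Or.inr (hk.unique hs)

theorem IsOm.trichotomy {n m : V} (hn : IsOm n) (hm : IsOm m) : Mem m n ∨ m = n ∨ Mem n m := by
  refine om_induction (fun n => ∀ m, IsOm m → Mem m n ∨ m = n ∨ Mem n m) ?_ ?_ hn m hm
  · intro e he m hm
    have := hm.empty_mem he
    tauto
  · intro x y hx ih hs m hm
    rw [hs]
    rcases ih m hm with h | rfl | h
    · exact Or.inl (Or.inl h)
    · exact Or.inl (Or.inr rfl)
    · have := hm.succ_mem h hs
      tauto

noncomputable instance : LinearOrder (OmegaHat V) where
  le m n := m < n ∨ m = n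
  lt m n := m < n
  le_refl m := Or.inr rfl
  le_trans a b c hab hbc := by
    rcases hab with h | rfl
    · rcases hbc with h' | rfl
      · exact Or.inl (IsOm.mem_trans c.2 _ _ h h')
      · exact Or.inl h
    · exact hbc
  lt_iff_le_not_ge a b := by
    constructor
    · intro h
      refine ⟨Or.inl h, ?_⟩
      rintro (h' | rfl)
      · exact mem_irrefl _ (IsOm.mem_trans a.2 _ _ h h')
      · exact mem_irrefl _ h
    · rintro ⟨h | rfl, h'⟩
      · exact h
      · exact absurd (Or.inr rfl) h'
  le_antisymm a b hab hba := by
    rcases hab with h | rfl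
    · rcases hba with h' | rfl
      · exact absurd (IsOm.mem_trans a.2 _ _ h h') (mem_irrefl _)
      · rfl
    · rfl
  le_total a b := by
    rcases IsOm.trichotomy a.2 b.2 with h | h | h
    · exact Or.inr (Or.inl h)
    · exact Or.inr (Or.inr (Subtype.ext h))
    · exact Or.inl (Or.inl h)
  toDecidableLE := Classical.decRel _

theorem le_iff_mem {m n : OmegaHat V} : m ≤ n ↔ Mem m.1 n.1 ∨ m.1 = n.1 :=
  or_congr Iff.rfl Subtype.ext_iff

noncomputable instance : OrderBot (OmegaHat V) where
  bot := ⟨exists_isEmptySet.choose, exists_isEmptySet.choose_spec.isOm⟩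
  bot_le n := le_iff_mem.2 (IsOm.empty_mem n.2 exists_isEmptySet.choose_spec)

theorem isEmptySet_bot : IsEmptySet (⊥ : OmegaHat V).1 := exists_isEmptySet.choose_spec

/-- The successor of a natural number of the structure. -/
noncomputable def OmegaHat.succ (n : OmegaHat V) : OmegaHat V :=
  ⟨(exists_isSucc n.1).choose, IsOm.succ n.2 (exists_isSucc n.1).choose_spec⟩

theorem OmegaHat.isSucc_succ (n : OmegaHat V) : IsSucc n.succ.1 n.1 :=
  (exists_isSucc n.1).choose_spec

theorem OmegaHat.lt_succ_iff {m n : OmegaHat V} : m < n.succ ↔ m ≤ n := by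
  rw [lt_iff_mem, n.isSucc_succ, le_iff_mem]

theorem OmegaHat.lt_succ (n : OmegaHat V) : n < n.succ := lt_succ_iff.2 le_rfl

theorem OmegaHat.succ_le_iff {m n : OmegaHat V} : m.succ ≤ n ↔ m < n := by
  rw [← not_lt, lt_succ_iff, not_le]

theorem OmegaHat.eq_bot_or_succ (n : OmegaHat V) : n = ⊥ ∨ ∃ m : OmegaHat V, n = m.succ := by
  rcases IsOm.empty_or_succ n.2 with h | ⟨m, hm, h⟩
  · exact Or.inl (Subtype.ext (h.unique isEmptySet_bot))
  · exact Or.inr ⟨⟨m, hm⟩, Subtype.ext (h.unique (OmegaHat.isSucc_succ ⟨m, hm⟩))⟩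

/-- A definable set of natural numbers of the structure that is not empty has a least element. -/
theorem exists_least (D : V → Prop) [Def₁ D] (h : ∃ n : OmegaHat V, D n.1) :
    ∃ n : OmegaHat V, D n.1 ∧ ∀ m : OmegaHat V, D m.1 → n ≤ m := by
  obtain ⟨o, ho⟩ := exists_omega (V := V)
  obtain ⟨x, hx⟩ := exists_sep o D
  obtain ⟨n, hn⟩ := h
  obtain ⟨y, hy, hmin⟩ := hV.out.foundation x ⟨n.1, (hx _).2 ⟨(ho _).2 n.2, hn⟩⟩
  rw [hx, ho] at hy
  refine ⟨⟨y, hy.1⟩, hy.2, fun m hm => not_lt.1 fun hlt => ?_⟩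
  exact hmin m.1 ((hx _).2 ⟨(ho _).2 m.2, hm⟩) hlt

/-- A definable set of natural numbers of the structure that contains `0` contains a longest
initial segment below a given bound. -/
theorem exists_max_prefix (D : V → Prop) [Def₁ D] (d : OmegaHat V)
    (h0 : D (⊥ : OmegaHat V).1) : ∃ m ≤ d, (∀ k ≤ m, D k.1) ∧
      ∀ m' ≤ d, (∀ k ≤ m', D k.1) → m' ≤ m := by
  by_cases h : ∃ k ≤ d, ¬ D k.1
  · obtain ⟨k, hk, hD⟩ := h
    obtain ⟨l, hl, hmin⟩ := exists_least (fun x => ¬ D x) ⟨k, hD⟩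
    rcases l.eq_bot_or_succ with rfl | ⟨m, rfl⟩
    · exact absurd h0 hl
    · refine ⟨m, m.lt_succ.le.trans ((hmin k hD).trans hk), fun j hj => ?_, fun m' _ hm' => ?_⟩
      · by_contra hj'
        exact absurd (OmegaHat.succ_le_iff.1 (hmin j hj')) hj.not_gt
      · exact OmegaHat.lt_succ_iff.1 (not_le.1 fun hle => hl (hm' _ hle))
  · push Not at h
    exact ⟨d, le_rfl, h, fun m' hm' _ => hm'⟩

end Omega

/-! ### Finite sets of the structure -/

section Cover

variable {V : Type u} [setLang.Structure V]

/-- The structure thinks that `X` is finite: some function of the structure with a natural number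
of the structure as its domain takes all elements of `X` as values. -/
def Cov (X : V) : Prop :=
  ∃ n f : V, IsOm n ∧ (∀ i x y, PairMem f i x → PairMem f i y → x = y) ∧
    ∀ x, Mem x X → ∃ i, Mem i n ∧ PairMem f i x

instance defCov {n : ℕ} (s : (Fin n → V) → V) [Tm s] : Def (fun v => Cov (s v)) := by
  unfold Cov; infer_instance

theorem Cov.mono {X Z : V} (h : Cov X) (hZ : IsSubset Z X) : Cov Z := by
  obtain ⟨n, f, hn, hf, hc⟩ := h
  exact ⟨n, f, hn, hf, fun x hx => hc x (hZ x hx)⟩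

variable [hV : Fact (IsModelZFCMinus V)]

/-- Every definable relation between elements of `A` and elements of `B` is represented by a set of
ordered pairs. -/
theorem exists_graph (A B : V) (R : V → V → Prop) [Def₂ R] :
    ∃ f, (∀ p, Mem p f ↔ ∃ i x, IsOPair p i x ∧ Mem i A ∧ Mem x B ∧ R i x) ∧
      ∀ i x, PairMem f i x ↔ Mem i A ∧ Mem x B ∧ R i x := by
  have h1 : ∀ a, ∃ P, ∀ p, Mem p P ↔ ∃ b, Mem b B ∧ IsOPair p a b := fun a =>
    exists_image B (fun b p => IsOPair p a b) fun b _ =>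
      ⟨opair a b, isOPair_opair a b, fun p hp => isOPair_iff.1 hp⟩
  obtain ⟨F, hF⟩ := exists_image A (fun a P => ∀ p, Mem p P ↔ ∃ b, Mem b B ∧ IsOPair p a b)
    fun a _ => by
      obtain ⟨P, hP⟩ := h1 a
      exact ⟨P, hP, fun Q hQ => ext_of fun z => by rw [hQ, hP]⟩
  obtain ⟨U, hU⟩ := hV.out.union F
  obtain ⟨f, hf⟩ := exists_sep U fun p => ∃ i x, IsOPair p i x ∧ Mem i A ∧ Mem x B ∧ R i x
  have key : ∀ p, Mem p f ↔ ∃ i x, IsOPair p i x ∧ Mem i A ∧ Mem x B ∧ R i x := by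
    intro p
    rw [hf, and_iff_right_iff_imp]
    rintro ⟨i, x, hp, hi, hx, -⟩
    obtain ⟨P, hP⟩ := h1 i
    exact (hU p).2 ⟨P, (hF P).2 ⟨i, hi, hP⟩, (hP p).2 ⟨x, hx, hp⟩⟩
  refine ⟨f, key, fun i x => ?_⟩
  rw [pairMem_iff, key]
  constructor
  · rintro ⟨j, y, hp, h⟩
    obtain ⟨rfl, rfl⟩ := (isOPair_opair i x).inj hp
    exact h
  · exact fun h => ⟨i, x, isOPair_opair i x, h⟩

theorem Cov.insert {X Z : V} (a : V) (h : Cov X) (hZ : ∀ z, Mem z Z → Mem z X ∨ z = a) :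
    Cov Z := by
  obtain ⟨n, f, hn, hf, hc⟩ := h
  obtain ⟨m, hm⟩ := exists_isSucc n
  obtain ⟨g, -, hg⟩ := exists_graph m Z fun i x => (Mem i n ∧ PairMem f i x) ∨ (i = n ∧ x = a)
  refine ⟨m, g, hn.succ hm, fun i x y hx hy => ?_, fun x hx => ?_⟩
  · rw [hg] at hx hy
    rcases hx.2.2 with ⟨h1, h2⟩ | ⟨rfl, rfl⟩
    · rcases hy.2.2 with ⟨h3, h4⟩ | ⟨rfl, rfl⟩
      · exact hf i x y h2 h4
      · exact absurd h1 (mem_irrefl _)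
    · rcases hy.2.2 with ⟨h3, h4⟩ | ⟨-, rfl⟩
      · exact absurd h3 (mem_irrefl _)
      · rfl
  · rcases hZ x hx with h | rfl
    · obtain ⟨i, hi, hfi⟩ := hc x h
      exact ⟨i, (hm i).2 (Or.inl hi), (hg _ _).2 ⟨(hm i).2 (Or.inl hi), hx, Or.inl ⟨hi, hfi⟩⟩⟩
    · exact ⟨n, (hm n).2 (Or.inr rfl), (hg _ _).2 ⟨(hm n).2 (Or.inr rfl), hx, Or.inr ⟨rfl, rfl⟩⟩⟩

theorem Cov.image {X Z : V} (h : Cov X) (R : V → V → Prop) [Def₂ R]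
    (hR : ∀ x, Mem x X → ∀ y y', R x y → R x y' → y = y')
    (hZ : ∀ z, Mem z Z → ∃ x, Mem x X ∧ R x z) : Cov Z := by
  obtain ⟨n, f, hn, hf, hc⟩ := h
  obtain ⟨g, -, hg⟩ := exists_graph n Z fun i z => ∃ x, Mem x X ∧ PairMem f i x ∧ R x z
  refine ⟨n, g, hn, fun i y y' hy hy' => ?_, fun z hz => ?_⟩
  · obtain ⟨-, -, x, hx, hfx, hxy⟩ := (hg _ _).1 hy
    obtain ⟨-, -, x', hx', hfx', hxy'⟩ := (hg _ _).1 hy'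
    obtain rfl := hf i x x' hfx hfx'
    exact hR x hx y y' hxy hxy'
  · obtain ⟨x, hx, hxz⟩ := hZ z hz
    obtain ⟨i, hi, hfi⟩ := hc x hx
    exact ⟨i, hi, (hg _ _).2 ⟨hi, hz, x, hx, hfi, hxz⟩⟩

theorem IsEmptySet.cov {e : V} (he : IsEmptySet e) : Cov e :=
  ⟨e, e, he.isOm, fun _ _ _ hx => absurd (pairMem_iff.1 hx) (he _), fun x hx => absurd hx (he x)⟩

theorem IsOm.cov {n : V} (hn : IsOm n) : Cov n := by
  obtain ⟨f, -, hf⟩ := exists_graph n n fun i x => i = x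
  refine ⟨n, f, hn, fun i x y hx hy => ?_, fun x hx => ⟨x, hx, (hf _ _).2 ⟨hx, hx, rfl⟩⟩⟩
  rw [← ((hf _ _).1 hx).2.2, ← ((hf _ _).1 hy).2.2]

theorem Cov.union {X Y Z : V} (hX : Cov X) (hY : Cov Y)
    (hZ : ∀ z, Mem z Z → Mem z X ∨ Mem z Y) : Cov Z := by
  obtain ⟨n, f, hn, hf, hc⟩ := hY
  refine om_induction (fun m => ∀ Z, (∀ z, Mem z Z → Mem z X ∨ ∃ i, Mem i m ∧ PairMem f i z) →
    Cov Z) ?_ ?_ hn Z fun z hz => (hZ z hz).imp_right (hc z)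
  · intro e he Z hZ
    refine hX.mono fun z hz => (hZ z hz).resolve_right ?_
    rintro ⟨i, hi, -⟩
    exact he i hi
  · intro m m' _ ih hs Z hZ
    obtain ⟨Z₀, hZ₀⟩ := exists_sep Z fun z => Mem z X ∨ ∃ i, Mem i m ∧ PairMem f i z
    have hcov := ih Z₀ fun z hz => ((hZ₀ z).1 hz).2
    by_cases h : ∃ a, PairMem f m a
    · obtain ⟨a, ha⟩ := h
      refine hcov.insert a fun z hz => ?_
      rcases hZ z hz with h | ⟨i, hi, hfi⟩
      · exact Or.inl ((hZ₀ z).2 ⟨hz, Or.inl h⟩)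
      · rcases (hs i).1 hi with h | rfl
        · exact Or.inl ((hZ₀ z).2 ⟨hz, Or.inr ⟨i, h, hfi⟩⟩)
        · exact Or.inr (hf _ _ _ hfi ha)
    · refine hcov.mono fun z hz => (hZ₀ z).2 ⟨hz, ?_⟩
      refine (hZ z hz).imp_right ?_
      rintro ⟨i, hi, hfi⟩
      rcases (hs i).1 hi with h' | rfl
      · exact ⟨i, h', hfi⟩
      · exact absurd ⟨z, hfi⟩ h

theorem Cov.exists_superset {Q X : V} (hQ : Cov Q) (hX : Cov X) (R : V → V → Prop) [Def₂ R]
    (hR : ∀ x, Mem x X → ∃! y, R x y) :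
    ∃ Q', Cov Q' ∧ IsSubset Q Q' ∧ ∀ x, Mem x X → ∀ y, R x y → Mem y Q' := by
  obtain ⟨I, hI⟩ := exists_image X R hR
  obtain ⟨Q', hQ'⟩ := exists_union Q I
  have hIc : Cov I := hX.image R (fun x hx y y' hy hy' => (hR x hx).unique hy hy')
    fun z hz => (hI z).1 hz
  exact ⟨Q', hQ.union hIc fun z hz => (hQ' z).1 hz, fun z hz => (hQ' z).2 (Or.inl hz),
    fun x hx y hy => (hQ' y).2 (Or.inr ((hI y).2 ⟨x, hx, hy⟩))⟩

/-- The subsets of a finite set form a finite set, although there is no power set axiom. -/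
theorem Cov.powerset {X : V} (hX : Cov X) : ∃ Q, Cov Q ∧ ∀ y, IsSubset y X → Mem y Q := by
  obtain ⟨n, f, hn, hf, hc⟩ := hX
  have key : ∃ Q, Cov Q ∧ ∀ y, (∀ z, Mem z y → ∃ i, Mem i n ∧ PairMem f i z) → Mem y Q := by
    refine om_induction (fun m => ∃ Q, Cov Q ∧
      ∀ y, (∀ z, Mem z y → ∃ i, Mem i m ∧ PairMem f i z) → Mem y Q) ?_ ?_ hn
    · intro e he
      obtain ⟨Q, hQ⟩ := exists_insert e e
      refine ⟨Q, he.cov.insert e fun z hz => (hQ z).1 hz, fun y hy => (hQ y).2 (Or.inr ?_)⟩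
      refine IsEmptySet.unique (fun z hz => ?_) he
      obtain ⟨i, hi, -⟩ := hy z hz
      exact he i hi
    · rintro m m' _ ⟨Q, hQ, hQy⟩ hs
      by_cases h : ∃ a, PairMem f m a
      · obtain ⟨a, ha⟩ := h
        obtain ⟨Q', hQ', hsub, hQ'y⟩ := hQ.exists_superset hQ
          (fun y w => ∀ z, Mem z w ↔ Mem z y ∨ z = a) fun y _ => by
            obtain ⟨w, hw⟩ := exists_insert y a
            exact ⟨w, hw, fun w' hw' => ext_of fun z => by rw [hw, hw']⟩
        refine ⟨Q', hQ', fun y hy => ?_⟩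
        obtain ⟨y₀, hy₀⟩ := exists_sep y fun z => ∃ i, Mem i m ∧ PairMem f i z
        have hy₀Q := hQy y₀ fun z hz => ((hy₀ z).1 hz).2
        have hor : ∀ z, Mem z y → Mem z y₀ ∨ z = a := by
          intro z hz
          obtain ⟨i, hi, hfi⟩ := hy z hz
          rcases (hs i).1 hi with h | rfl
          · exact Or.inl ((hy₀ z).2 ⟨hz, i, h, hfi⟩)
          · exact Or.inr (hf _ _ _ hfi ha)
        by_cases hay : Mem a y
        · refine hQ'y y₀ hy₀Q y fun z => ⟨hor z, ?_⟩
          rintro (h | rfl)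
          exacts [((hy₀ z).1 h).1, hay]
        · obtain rfl : y₀ = y := by
            refine ext_of fun z => ⟨fun h => ((hy₀ z).1 h).1, fun h => ?_⟩
            refine (hor z h).resolve_right ?_
            rintro rfl
            exact hay h
          exact hsub _ hy₀Q
      · refine ⟨Q, hQ, fun y hy => hQy y fun z hz => ?_⟩
        obtain ⟨i, hi, hfi⟩ := hy z hz
        rcases (hs i).1 hi with h' | rfl
        · exact ⟨i, h', hfi⟩
        · exact absurd ⟨z, hfi⟩ h
  obtain ⟨Q, hQ, hQy⟩ := key
  exact ⟨Q, hQ, fun y hy => hQy y fun z hz => hc z (hy z hz)⟩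

theorem Cov.prod {X Y : V} (hX : Cov X) (hY : Cov Y) :
    ∃ Q, Cov Q ∧ ∀ x y, Mem x X → Mem y Y → Mem (opair x y) Q := by
  obtain ⟨n, f, hn, hf, hc⟩ := hY
  have key : ∃ Q, Cov Q ∧ ∀ x, Mem x X → ∀ i, Mem i n → ∀ y, PairMem f i y →
      ∀ p, IsOPair p x y → Mem p Q := by
    refine om_induction (fun m => ∃ Q, Cov Q ∧ ∀ x, Mem x X → ∀ i, Mem i m → ∀ y, PairMem f i y →
      ∀ p, IsOPair p x y → Mem p Q) ?_ ?_ hn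
    · intro e he
      exact ⟨e, he.cov, fun x _ i hi => absurd hi (he i)⟩
    · rintro m m' _ ⟨Q, hQ, hQy⟩ hs
      by_cases h : ∃ a, PairMem f m a
      · obtain ⟨a, ha⟩ := h
        obtain ⟨Q', hQ', hsub, hQ'y⟩ := hQ.exists_superset hX (fun x p => IsOPair p x a)
          fun x _ => ⟨opair x a, isOPair_opair x a, fun p hp => isOPair_iff.1 hp⟩
        refine ⟨Q', hQ', fun x hx i hi y hy p hp => ?_⟩
        rcases (hs i).1 hi with h | rfl
        · exact hsub _ (hQy x hx i h y hy p hp)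
        · obtain rfl := hf _ _ _ hy ha
          exact hQ'y x hx p hp
      · refine ⟨Q, hQ, fun x hx i hi y hy p hp => ?_⟩
        rcases (hs i).1 hi with h' | rfl
        · exact hQy x hx i h' y hy p hp
        · exact absurd ⟨y, hy⟩ h
  obtain ⟨Q, hQ, hQy⟩ := key
  refine ⟨Q, hQ, fun x y hx hy => ?_⟩
  obtain ⟨i, hi, hfi⟩ := hc y hy
  exact hQy x hx i hi y hfi _ (isOPair_opair x y)

end Cover

/-! ### Cofinal sequences in linear orders -/

section Orders

open Cardinal Ordinal Set

/-- A nonempty linear order without a greatest element has a strictly increasing cofinal sequence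
whose length is a regular cardinal. -/
theorem exists_strictMono_cofinal (A : Type u) [LinearOrder A] [Nonempty A] [NoMaxOrder A] :
    ∃ μ : Cardinal.{u}, μ.IsRegular ∧ μ ≤ #A ∧ ∃ f : Iio μ.ord → A, StrictMono f ∧
      ∀ a, ∃ i, a ≤ f i := by
  classical
  -- A cofinal set on which the given order agrees with a well-order of `A`.
  let r : A → A → Prop := WellOrderingRel
  set s : Set A := {a | ∀ b, r b a → b < a} with hs
  have hcof : IsCofinal s := isCofinal_setOfPred_imp_lt r
  have hwf : WellFoundedLT s := by
    refine ⟨Subrelation.wf (r := InvImage r Subtype.val) ?_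
      (InvImage.wf _ (IsWellFounded.wf (r := r)))⟩
    intro a b hab
    rcases trichotomous_of r a.1 b.1 with h | h | h
    · exact h
    · exact absurd (Subtype.ext h) hab.ne
    · exact absurd (a.2 b.1 h) (not_lt.2 hab.le)
  obtain ⟨t, ht, htype⟩ := exists_ord_cof_eq s
  have hne : Nonempty s := hcof.nonempty.to_subtype
  have hcs : Order.cof s = Order.cof A := Order.cof_eq_of_isCofinal hcof
  have hinf : ℵ₀ ≤ Order.cof s := hcs ▸ Order.aleph0_le_cof
  refine ⟨Order.cof s, ⟨hinf, (Order.cof_ord_cof s).ge⟩, hcs ▸ Order.cof_le_cardinalMk _, ?_⟩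
  rw [← htype]
  let e := enum (α := t) (· < ·)
  refine ⟨fun i => (e i : t).1.1, fun i j hij => ?_, fun a => ?_⟩
  · have : e i < e j := e.map_rel_iff.2 hij
    exact this
  · obtain ⟨b, hb, hab⟩ := hcof a
    obtain ⟨c, hc, hbc⟩ := ht ⟨b, hb⟩
    refine ⟨e.symm ⟨c, hc⟩, ?_⟩
    change a ≤ (e (e.symm ⟨c, hc⟩)).1.1
    rw [e.apply_symm_apply]
    exact hab.trans hbc

end Orders

/-! ### Consequences of the definitions of `𝔭` and `𝔱` -/

section Fill

open Cardinal Ordinal Set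

variable {V : Type u} [setLang.Structure V]

theorem pCard_le {μ ν : Cardinal.{u}} (h : (μ, ν) ∈ cutSpectrum (OmegaHat V)) :
    pCard V ≤ μ + ν :=
  csInf_le' ⟨_, h, rfl⟩

/-- The definition of `𝔱` concerns the trees that have unbounded increasing sequences; in the other
trees all increasing sequences are bounded anyway. -/
theorem exists_upperBound_of_lt_tCard {n : OmegaHat V} (hn : ¬ IsEmptySet n.1)
    {μ : Cardinal.{u}} (hμ : μ < tCard V) (s : Iio μ.ord → SeqTree n) (hs : StrictMono s) :
    BddAbove (range s) := by
  by_contra hb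
  set S : Set Cardinal.{u} :=
    {μ | ∃ s : Iio μ.ord → SeqTree n, StrictMono s ∧ ¬ BddAbove (range s)}
  have hmem : sInf S ∈ S := csInf_mem ⟨μ, s, hs, hb⟩
  refine hμ.not_ge (le_trans (csInf_le' ⟨n, hn, hmem, fun x hx => csInf_le' hx⟩) ?_)
  exact csInf_le' ⟨s, hs, hb⟩

variable [hV : Fact (IsModelZFCMinus V)]

/-- Two sets of fewer than `𝔭` natural numbers, one below the other, can be separated. -/
theorem exists_between_of_lt_pCard (hp : ℵ₀ ≤ pCard V) {A B : Set (OmegaHat V)}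
    (hA : #A < pCard V) (hB : #B < pCard V) (hB0 : B.Nonempty)
    (hAB : ∀ a ∈ A, ∀ b ∈ B, a ≤ b) :
    ∃ c, (∀ a ∈ A, a ≤ c) ∧ ∀ b ∈ B, c ≤ b := by
  by_cases hA0 : A.Nonempty
  swap
  · exact ⟨⊥, fun a ha => absurd ⟨a, ha⟩ hA0, fun b _ => bot_le⟩
  by_cases hmax : ∃ m ∈ A, ∀ a ∈ A, a ≤ m
  · obtain ⟨m, hm, h⟩ := hmax
    exact ⟨m, h, hAB m hm⟩
  by_cases hmin : ∃ m ∈ B, ∀ b ∈ B, m ≤ b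
  · obtain ⟨m, hm, h⟩ := hmin
    exact ⟨m, fun a ha => hAB a ha m hm, h⟩
  push Not at hmax hmin
  have : Nonempty A := hA0.to_subtype
  have : Nonempty Bᵒᵈ := hB0.to_subtype
  have : NoMaxOrder A := ⟨fun a => by
    obtain ⟨b, hb, h⟩ := hmax a.1 a.2
    exact ⟨⟨b, hb⟩, h⟩⟩
  have : NoMaxOrder (B)ᵒᵈ := ⟨fun a => by
    obtain ⟨b, hb, h⟩ := hmin a.1 a.2
    exact ⟨OrderDual.toDual (⟨b, hb⟩ : B), h⟩⟩
  obtain ⟨μ, hμ, hμA, f, hf, hfc⟩ := exists_strictMono_cofinal A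
  obtain ⟨ν, hν, hνB, g, hg, hgc⟩ := exists_strictMono_cofinal (B)ᵒᵈ
  have hpre : IsPreCut (fun i => (f i).1) (fun i => (OrderDual.ofDual (g i)).1) := by
    intro i i' hi j j' hj
    obtain ⟨a, ha, h⟩ := hmax _ (f i').2
    exact ⟨hf hi, h.trans_le (hAB a ha _ (OrderDual.ofDual (g j')).2), hg hj⟩
  by_contra hno
  refine (add_lt_of_lt hp (hμA.trans_lt hA) (hνB.trans_lt hB)).not_ge
    (pCard_le ⟨hμ, hν, _, _, hpre, ?_⟩)
  rintro ⟨c, hc⟩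
  refine hno ⟨c, fun a ha => ?_, fun b hb => ?_⟩
  · obtain ⟨i, hi⟩ := hfc ⟨a, ha⟩
    obtain ⟨j, -⟩ := hgc (OrderDual.toDual ⟨_, hB0.some_mem⟩)
    exact le_trans (Subtype.coe_le_coe.2 hi) (hc i j).1.le
  · obtain ⟨j, hj⟩ := hgc (OrderDual.toDual ⟨b, hb⟩)
    obtain ⟨i, -⟩ := hfc ⟨_, hA0.some_mem⟩
    have hj' : OrderDual.ofDual (g j) ≤ ⟨b, hb⟩ := hj
    exact (hc i j).2.le.trans hj'

/-- Overspill for fewer than `𝔭` definable properties: if each of them holds at every number up to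
some `a i`, then some number above all `a i` satisfies all of them. -/
theorem exists_overspill (hp : ℵ₀ ≤ pCard V) {ι ι' : Type u} (hι : #ι < pCard V)
    (hι' : #ι' < pCard V) [Nonempty ι] [Nonempty ι'] (a : ι → OmegaHat V) (d : OmegaHat V)
    (had : ∀ i, a i ≤ d) (Φ : ι' → V → Prop) [hΦ : ∀ j, Def₁ (Φ j)]
    (h : ∀ i j, ∀ k ≤ a i, Φ j k.1) :
    ∃ c ≤ d, (∀ i, a i ≤ c) ∧ ∀ j, ∀ k ≤ c, Φ j k.1 := by
  choose b hbd hbΦ hbmax using fun j => exists_max_prefix (Φ j) d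
    (h (Classical.arbitrary ι) j ⊥ bot_le)
  obtain ⟨c, hca, hcb⟩ := exists_between_of_lt_pCard (V := V) hp (A := range a) (B := range b)
    (mk_range_le.trans_lt hι) (mk_range_le.trans_lt hι') (range_nonempty b) (by
      rintro _ ⟨i, rfl⟩ _ ⟨j, rfl⟩
      exact hbmax j _ (had i) (h i j))
  have hcb' : ∀ j, c ≤ b j := fun j => hcb _ ⟨j, rfl⟩
  exact ⟨c, (hcb' (Classical.arbitrary ι')).trans (hbd _), fun i => hca _ ⟨i, rfl⟩,
    fun j k hk => hbΦ j k (hk.trans (hcb' j))⟩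

/-- Increasing sequences in the tree `n^{<n}` along a linear order with fewer than `𝔱` elements
are bounded. -/
theorem exists_upperBound {n : OmegaHat V} (hn : n ≠ ⊥) {ι : Type u} [LinearOrder ι]
    [Nonempty ι] (hι : #ι < tCard V) (s : ι → SeqTree n) (hs : StrictMono s) :
    ∃ t : SeqTree n, ∀ i, s i ≤ t := by
  by_cases hmax : ∃ m : ι, ∀ i, i ≤ m
  · obtain ⟨m, hm⟩ := hmax
    exact ⟨s m, fun i => hs.monotone (hm i)⟩
  push Not at hmax
  have : NoMaxOrder ι := ⟨hmax⟩
  obtain ⟨μ, -, hμ, f, hf, hfc⟩ := exists_strictMono_cofinal ι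
  have hn' : ¬ IsEmptySet n.1 := fun h => hn (Subtype.ext (h.unique isEmptySet_bot))
  obtain ⟨t, ht⟩ := exists_upperBound_of_lt_tCard hn' (hμ.trans_lt hι) (s ∘ f) (hs.comp hf)
  refine ⟨t, fun i => ?_⟩
  obtain ⟨j, hj⟩ := hfc i
  exact (hs.monotone hj).trans (ht ⟨j, rfl⟩)

end Fill

/-! ### Transfinite recursion -/

section Recursion

/-- Transfinite recursion in which each value has to satisfy a condition on the earlier values. -/
theorem exists_transfinite_choice {ι X : Type*} [LinearOrder ι] [WellFoundedLT ι] [Nonempty X]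
    (R : ∀ j : ι, (∀ i, i < j → X) → X → Prop)
    (h : ∀ j f, (∀ i (hi : i < j), R i (fun k hk => f k (hk.trans hi)) (f i hi)) → ∃ x, R j f x) :
    ∃ F : ι → X, ∀ j, R j (fun i _ => F i) (F j) := by
  classical
  let step : ∀ j : ι, (∀ i, i < j → X) → X := fun j f =>
    if H : ∃ x, R j f x then H.choose else Classical.arbitrary X
  let F : ι → X := (wellFounded_lt (α := ι)).fix step
  have hF : ∀ j, F j = step j fun i _ => F i := fun j => WellFounded.fix_eq _ _ _
  refine ⟨F, fun j => ?_⟩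
  induction j using WellFoundedLT.induction with
  | ind j ih =>
    have H : ∃ x, R j (fun i _ => F i) x := h j _ fun i hi => ih i hi
    rw [hF j]
    simp only [step, dif_pos H]
    exact H.choose_spec

end Recursion

/-! ### Paths through the tree -/

section Path

open Cardinal Ordinal Set

variable {V : Type u} [setLang.Structure V]

theorem PairMem.mono {r r' a b : V} (h : PairMem r a b) (hr : IsSubset r r') : PairMem r' a b := by
  obtain ⟨p, hp, hpr⟩ := h
  exact ⟨p, hp, hr p hpr⟩

theorem IsFunction.mem {f m n i v : V} (hf : IsFunction f m n) (h : PairMem f i v) :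
    Mem i m ∧ Mem v n := by
  obtain ⟨p, hp, hpf⟩ := h
  obtain ⟨i', v', hi, hv, hp'⟩ := hf.1 p hpf
  obtain ⟨rfl, rfl⟩ := hp.inj hp'
  exact ⟨hi, hv⟩

theorem IsFunction.unique {f m n i v w : V} (hf : IsFunction f m n) (h : PairMem f i v)
    (h' : PairMem f i w) : v = w :=
  (hf.2 i (hf.mem h).1).unique h h'

variable [hV : Fact (IsModelZFCMinus V)]

/-- The conditions on the stage `(s, ν)` with index `j` in the construction of a path: `s` has
domain `{0, …, ν}` and ends in `x j`, increases with respect to `Le`, extends the earlier stages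
and, from the end of the earlier stage `i` on, has all its values in `A i`. There is still room for
infinitely many values below `n`, witnessed by the descending sequence `b`. -/
structure IsStage {ι : Type u} [LT ι] (n : OmegaHat V) (b : ℕ → OmegaHat V) (Le : V → V → Prop)
    (A : ι → V → Prop) (x : ι → OmegaHat V) (j : ι)
    (f : ∀ i, i < j → SeqTree n × OmegaHat V) (q : SeqTree n × OmegaHat V) : Prop where
  isFunction : IsFunction q.1.1 q.2.succ.1 n.1
  last : PairMem q.1.1 q.2.1 (x j).1
  mono : ∀ k k', k ≤ k' → k' ≤ q.2 →
    ∃ v v', PairMem q.1.1 k.1 v ∧ PairMem q.1.1 k'.1 v' ∧ Le v v'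
  lt : ∀ i hi, (f i hi).2 < q.2
  subset : ∀ i hi, (f i hi).1 ≤ q.1
  holds : ∀ i hi k, (f i hi).2 ≤ k → k ≤ q.2 → ∃ v, PairMem q.1.1 k.1 v ∧ A i v
  room : ∀ k, q.2 < b k

theorem exists_empty_seqTree {n : OmegaHat V} (hn : n ≠ ⊥) : Nonempty (SeqTree n) :=
  ⟨⟨(⊥ : OmegaHat V).1, ⊥, bot_lt_iff_ne_bot.2 hn, fun p hp => absurd hp (isEmptySet_bot p),
    fun p hp => absurd hp (isEmptySet_bot p)⟩⟩

/-- A node of the tree can be cut off at `c` and continued with the value `x`. -/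
theorem exists_truncate_append {n : OmegaHat V} (s : SeqTree n) {c x : OmegaHat V}
    (hc : c.succ < n) (hx : x < n) (hs : ∀ k < c, ∃ v, PairMem s.1 k.1 v) :
    ∃ s' : SeqTree n, IsFunction s'.1 c.succ.1 n.1 ∧ PairMem s'.1 c.1 x.1 ∧
      ∀ k < c, ∀ v, PairMem s'.1 k.1 v ↔ PairMem s.1 k.1 v := by
  obtain ⟨m, -, hm⟩ := s.2
  obtain ⟨g, hg, hg'⟩ := exists_graph c.succ.1 n.1
    fun k v => (Mem k c.1 ∧ PairMem s.1 k v) ∨ (k = c.1 ∧ v = x.1)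
  have hlast : PairMem g c.1 x.1 :=
    (hg' _ _).2 ⟨(c.isSucc_succ _).2 (Or.inr rfl), hx, Or.inr ⟨rfl, rfl⟩⟩
  have hbelow : ∀ k < c, ∀ v, PairMem g k.1 v ↔ PairMem s.1 k.1 v := by
    intro k hk v
    rw [hg']
    constructor
    · rintro ⟨-, -, ⟨-, h⟩ | ⟨h, -⟩⟩
      · exact h
      · exact absurd (Subtype.ext h) hk.ne
    · exact fun h => ⟨(c.isSucc_succ _).2 (Or.inl hk), (hm.mem h).2, Or.inl ⟨hk, h⟩⟩
  have hfun : IsFunction g c.succ.1 n.1 := by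
    refine ⟨fun p hp => ?_, fun k hk => ?_⟩
    · obtain ⟨i, v, hp', hi, hv, -⟩ := (hg p).1 hp
      exact ⟨i, v, hi, hv, hp'⟩
    · rcases (c.isSucc_succ _).1 hk with h | rfl
      · have hko : IsOm k := IsOm.of_mem c.2 h
        obtain ⟨v, hv⟩ := hs ⟨k, hko⟩ h
        refine ⟨v, (hbelow ⟨k, hko⟩ h v).2 hv, fun w hw => ?_⟩
        exact hm.unique ((hbelow ⟨k, hko⟩ h w).1 hw) hv
      · refine ⟨x.1, hlast, fun w hw => ?_⟩
        rcases ((hg' _ _).1 hw).2.2 with ⟨h, -⟩ | ⟨-, h⟩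
        · exact absurd h (mem_irrefl _)
        · exact h
  exact ⟨⟨g, c.succ, hc, hfun⟩, hfun, hlast, hbelow⟩

section Step

variable {ι : Type u} [LinearOrder ι] {n : OmegaHat V} {b : ℕ → OmegaHat V} {Le : V → V → Prop}
  {A : ι → V → Prop} {x : ι → OmegaHat V} {j : ι}

/-- A node `s` above all earlier stages yields the next stage once the conditions hold for `s` below
some `c` that lies above all earlier lengths. -/
theorem exists_isStage_of_node (hb : StrictAnti b) (hbn : b 0 ≤ n) (hx : ∀ j, x j < n)
    (hLe : ∀ j, Le (x j).1 (x j).1) {f : ∀ i, i < j → SeqTree n × OmegaHat V}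
    (hA : ∀ i ≤ j, A i (x j).1)
    (hdom : ∀ i hi, IsFunction (f i hi).1.1 (f i hi).2.succ.1 n.1)
    (s : SeqTree n) (c : OmegaHat V) (hroom : ∀ k, c < b k) (hlt : ∀ i hi, (f i hi).2 < c)
    (hsub : ∀ i hi, (f i hi).1 ≤ s)
    (hholds : ∀ i hi k, (f i hi).2 ≤ k → k < c → ∃ v, PairMem s.1 k.1 v ∧ A i v)
    (hmono : ∀ k k', k ≤ k' → k' < c → ∃ v v', PairMem s.1 k.1 v ∧ PairMem s.1 k'.1 v' ∧ Le v v')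
    (hle : ∀ k < c, ∃ v, PairMem s.1 k.1 v ∧ Le v (x j).1) :
    ∃ q, IsStage n b Le A x j f q := by
  have hcn : c.succ < n :=
    (OmegaHat.succ_le_iff.2 (hroom 1)).trans_lt ((hb Nat.zero_lt_one).trans_le hbn)
  obtain ⟨s', hs', hlast, hbelow⟩ := exists_truncate_append s hcn (hx j)
    fun k hk => (hle k hk).imp fun _ h => h.1
  refine ⟨(s', c), hs', hlast, fun k k' hkk' hk' => ?_, hlt, fun i hi p hp => ?_,
    fun i hi k hik hkc => ?_, hroom⟩
  · rcases hk'.lt_or_eq with h | h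
    · obtain ⟨v, v', hv, hv', hvv'⟩ := hmono k k' hkk' h
      exact ⟨v, v', (hbelow k (hkk'.trans_lt h) v).2 hv, (hbelow k' h v').2 hv', hvv'⟩
    · obtain rfl : k' = c := h
      rcases hkk'.lt_or_eq with h | rfl
      · obtain ⟨v, hv, hvx⟩ := hle k h
        exact ⟨v, _, (hbelow k h v).2 hv, hlast, hvx⟩
      · exact ⟨_, _, hlast, hlast, hLe j⟩
  · obtain ⟨k, v, hk, hv, hkv⟩ := (hdom i hi).1 p hp
    have hko : IsOm k := IsOm.of_mem (f i hi).2.succ.2 hk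
    let l : OmegaHat V := ⟨k, hko⟩
    have hl : l < (f i hi).2.succ := hk
    have hlc : l < c := (OmegaHat.lt_succ_iff.1 hl).trans_lt (hlt i hi)
    obtain ⟨p', hp', hps'⟩ := (hbelow l hlc v).2 ⟨p, hkv, hsub i hi p hp⟩
    rwa [hkv.unique hp']
  · rcases (show k ≤ c from hkc).lt_or_eq with h | h
    · obtain ⟨v, hv, hvA⟩ := hholds i hi k hik h
      exact ⟨v, (hbelow k h v).2 hv, hvA⟩
    · obtain rfl : k = c := h
      exact ⟨_, hlast, hA i hi.le⟩

variable {f : ∀ i, i < j → SeqTree n × OmegaHat V}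
  (hf : ∀ i (hi : i < j), IsStage n b Le A x i (fun k hk => f k (hk.trans hi)) (f i hi))

include hf

theorem IsStage.monotone_node {i l : ι} (hil : i ≤ l) (hl : l < j) :
    (f i (hil.trans_lt hl)).1 ≤ (f l hl).1 := by
  rcases hil.lt_or_eq with h | rfl
  · exact (hf l hl).subset i h
  · exact le_rfl

theorem IsStage.monotone_length {i l : ι} (hil : i ≤ l) (hl : l < j) :
    (f i (hil.trans_lt hl)).2 ≤ (f l hl).2 := by
  rcases hil.lt_or_eq with h | rfl
  · exact ((hf l hl).lt i h).le
  · exact le_rfl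

theorem IsStage.holds_of_le (hA : ∀ j, ∀ i ≤ j, A i (x j).1) {i l : ι} (hil : i ≤ l) (hl : l < j)
    {k : OmegaHat V} (hik : (f i (hil.trans_lt hl)).2 ≤ k) (hkl : k ≤ (f l hl).2) :
    ∃ v, PairMem (f l hl).1.1 k.1 v ∧ A i v := by
  rcases hil.lt_or_eq with h | rfl
  · exact (hf l hl).holds i h k hik hkl
  · obtain rfl := le_antisymm hik hkl
    exact ⟨_, (hf i hl).last, hA i i le_rfl⟩

theorem IsStage.le_last (hLe' : ∀ u v w, Le u v → Le v w → Le u w) {l : ι} (hl : l < j)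
    (hxl : Le (x l).1 (x j).1) {k : OmegaHat V} (hk : k ≤ (f l hl).2) :
    ∃ v, PairMem (f l hl).1.1 k.1 v ∧ Le v (x j).1 := by
  obtain ⟨v, v', hv, hv', hvv'⟩ := (hf l hl).mono k _ hk le_rfl
  obtain rfl := (hf l hl).isFunction.unique hv' (hf l hl).last
  exact ⟨v, hv, hLe' _ _ _ hvv' hxl⟩

theorem IsStage.strictMono : StrictMono fun i : Iio j => (f i.1 i.2).1 := by
  intro i l hil
  refine ⟨(hf l.1 l.2).subset i.1 hil, fun hle => ?_⟩
  have h1 := (hf i.1 i.2).isFunction.mem ((hf l.1 l.2).last.mono hle)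
  exact ((hf l.1 l.2).lt i.1 hil).not_ge
    (OmegaHat.lt_succ_iff.1 (show (f l.1 l.2).2 < (f i.1 i.2).2.succ from h1.1))

set_option synthInstance.maxHeartbeats 200000 in
set_option synthInstance.maxSize 1000 in
/-- Each stage can be built after the earlier ones: below a limit, `𝔱` gives a node above them, and
`𝔭` gives a place, beyond all earlier lengths, up to which that node behaves well. -/
theorem exists_isStage [Def₂ Le] [∀ i, Def₁ (A i)] (hp : ℵ₀ < pCard V)
    (hpt : pCard V < tCard V) (hj : #(Iio j) < pCard V) (hb : StrictAnti b) (hbn : b 0 ≤ n)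
    (hx : ∀ j, x j < n) (hLe' : ∀ u v w, Le u v → Le v w → Le u w)
    (hLe : ∀ i j, i ≤ j → Le (x i).1 (x j).1) (hA : ∀ j, ∀ i ≤ j, A i (x j).1) :
    ∃ q, IsStage n b Le A x j f q := by
  have hn : n ≠ ⊥ := bot_lt_iff_ne_bot.1 (bot_le.trans_lt ((hb Nat.zero_lt_one).trans_le hbn))
  have hext := exists_isStage_of_node (f := f) hb hbn hx (fun j => hLe j j le_rfl) (hA j)
    (fun i hi => (hf i hi).isFunction)
  by_cases hne : Nonempty (Iio j)
  swap
  · have hne' : ∀ i, ¬ i < j := fun i hi => hne ⟨⟨i, hi⟩⟩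
    obtain ⟨s⟩ := exists_empty_seqTree hn
    exact hext s ⊥ (fun k => bot_le.trans_lt (hb k.lt_succ_self)) (fun i hi => absurd hi (hne' i))
      (fun i hi => absurd hi (hne' i)) (fun i hi => absurd hi (hne' i))
      (fun k k' _ h => absurd h not_lt_bot) (fun k h => absurd h not_lt_bot)
  by_cases hmax : ∃ l : Iio j, ∀ i : Iio j, i ≤ l
  · obtain ⟨⟨l, hl⟩, hlmax⟩ := hmax
    have hle : ∀ i, i < j → i ≤ l := fun i hi => hlmax ⟨i, hi⟩
    refine hext (f l hl).1 (f l hl).2.succ (fun k => ?_) (fun i hi => ?_)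
      (fun i hi => IsStage.monotone_node hf (hle i hi) hl)
      (fun i hi k hik hk => IsStage.holds_of_le hf hA (hle i hi) hl hik (OmegaHat.lt_succ_iff.1 hk))
      (fun k k' hkk' hk' => (hf l hl).mono k k' hkk' (OmegaHat.lt_succ_iff.1 hk'))
      (fun k hk => IsStage.le_last hf hLe' hl (hLe _ _ hl.le) (OmegaHat.lt_succ_iff.1 hk))
    · exact (OmegaHat.succ_le_iff.2 ((hf l hl).room (k + 1))).trans_lt (hb k.lt_succ_self)
    · exact OmegaHat.lt_succ_iff.2 (IsStage.monotone_length hf (hle i hi) hl)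
  -- At a limit, an upper bound in the tree is cut off where the earlier conditions still hold.
  push Not at hmax
  obtain ⟨t, ht⟩ := exists_upperBound hn (hj.trans hpt) _ (IsStage.strictMono hf)
  have hcard : #(Iio j × ULift.{u} ℕ) < pCard V := by
    rw [mk_prod, Cardinal.lift_id, Cardinal.lift_id]
    exact mul_lt_of_lt hp.le hj (by simpa using hp)
  -- The factor `ℕ` takes care of the room below each `b k`.
  obtain ⟨c, -, hac, hc⟩ := exists_overspill (V := V) hp.le (ι := Iio j) (ι' := Iio j × ULift.{u} ℕ)
    hj hcard (fun i => (f i.1 i.2).2) (b 0) (fun i => ((hf i.1 i.2).room 0).le)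
    (fun q y => Mem y (b q.2.down).1 ∧
      ((Mem (f q.1.1 q.1.2).2.1 y ∨ (f q.1.1 q.1.2).2.1 = y) → ∃ v, PairMem t.1 y v ∧ A q.1.1 v) ∧
      (∀ k, (Mem k y ∨ k = y) → ∃ v v', PairMem t.1 k v ∧ PairMem t.1 y v' ∧ Le v v') ∧
      ∃ v, PairMem t.1 y v ∧ Le v (x j).1) (by
    rintro ⟨i, hi⟩ ⟨⟨i', hi'⟩, m⟩ k hk
    have hl : max i i' < j := max_lt hi hi'
    have hkl : k ≤ (f _ hl).2 := le_trans hk (IsStage.monotone_length hf (le_max_left i i') hl)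
    refine ⟨lt_of_le_of_lt hk ((hf i hi).room m.down), fun h => ?_, fun k' hk' => ?_, ?_⟩
    · obtain ⟨v, hv, hvA⟩ := IsStage.holds_of_le hf hA (le_max_right i i') hl
        (le_iff_mem.2 h) hkl
      exact ⟨v, hv.mono (ht ⟨_, hl⟩), hvA⟩
    · have hk'o : IsOm k' := hk'.elim (IsOm.of_mem k.2) (fun h => h ▸ k.2)
      obtain ⟨v, v', hv, hv', hvv'⟩ := (hf _ hl).mono ⟨k', hk'o⟩ k (le_iff_mem.2 hk') hkl
      exact ⟨v, v', hv.mono (ht ⟨_, hl⟩), hv'.mono (ht ⟨_, hl⟩), hvv'⟩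
    · obtain ⟨v, hv, hvx⟩ := IsStage.le_last hf hLe' hl (hLe _ _ hl.le) hkl
      exact ⟨v, hv.mono (ht ⟨_, hl⟩), hvx⟩)
  obtain ⟨i₀⟩ := hne
  refine hext t c (fun k => (hc (i₀, ⟨k⟩) c le_rfl).1) (fun i hi => ?_) (fun i hi => ht ⟨i, hi⟩)
    (fun i hi k hik hk => (hc (⟨i, hi⟩, ⟨0⟩) k hk.le).2.1 (le_iff_mem.1 hik))
    (fun k k' hkk' hk' => (hc (i₀, ⟨0⟩) k' hk'.le).2.2.1 k.1 (le_iff_mem.1 hkk'))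
    (fun k hk => (hc (i₀, ⟨0⟩) k hk.le).2.2.2)
  obtain ⟨l, hl⟩ := hmax ⟨i, hi⟩
  exact ((hf l.1 l.2).lt i hl).trans_le (hac l)

end Step

/-- A sequence of numbers `x j` that increases for a definable transitive relation, with `x j` in
the definable sets `A i` for `i ≤ j`, is carried by one node `s` of the tree: `s` takes the value
`x j` at `ν j`, increases up to each `ν j`, and takes values in `A i` between `ν i` and `ν j`. -/
theorem exists_path {ι : Type u} [LinearOrder ι] [WellFoundedLT ι] [Nonempty ι] {n : OmegaHat V}
    {b : ℕ → OmegaHat V} (Le : V → V → Prop) (A : ι → V → Prop) (x : ι → OmegaHat V)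
    [Def₂ Le] [∀ i, Def₁ (A i)] (hp : ℵ₀ < pCard V) (hpt : pCard V < tCard V)
    (hι : #ι < tCard V) (hj : ∀ j : ι, #(Iio j) < pCard V) (hb : StrictAnti b) (hbn : b 0 ≤ n)
    (hx : ∀ j, x j < n) (hLe' : ∀ u v w, Le u v → Le v w → Le u w)
    (hLe : ∀ i j, i ≤ j → Le (x i).1 (x j).1) (hA : ∀ j, ∀ i ≤ j, A i (x j).1) :
    ∃ (s : SeqTree n) (ν : ι → OmegaHat V), StrictMono ν ∧ (∀ j, ν j < n) ∧
      (∀ j, PairMem s.1 (ν j).1 (x j).1) ∧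
      (∀ j k k', k ≤ k' → k' ≤ ν j →
        ∃ v v', PairMem s.1 k.1 v ∧ PairMem s.1 k'.1 v' ∧ Le v v') ∧
      ∀ i j k, ν i ≤ k → k ≤ ν j → ∃ v, PairMem s.1 k.1 v ∧ A i v := by
  have hn : n ≠ ⊥ := bot_lt_iff_ne_bot.1 (bot_le.trans_lt ((hb Nat.zero_lt_one).trans_le hbn))
  have := exists_empty_seqTree hn
  obtain ⟨F, hF⟩ := exists_transfinite_choice (IsStage n b Le A x) fun j f hf =>
    exists_isStage hf hp hpt (hj j) hb hbn hx hLe' hLe hA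
  have hmono : StrictMono fun i => (F i).1 := by
    intro i l hil
    refine ⟨(hF l).subset i hil, fun hle => ?_⟩
    have h1 := (hF i).isFunction.mem ((hF l).last.mono hle)
    exact ((hF l).lt i hil).not_ge
      (OmegaHat.lt_succ_iff.1 (show (F l).2 < (F i).2.succ from h1.1))
  obtain ⟨s, hs⟩ := exists_upperBound hn hι _ hmono
  refine ⟨s, fun i => (F i).2, fun i l hil => (hF l).lt i hil,
    fun j => ((hF j).room 0).trans_le hbn, fun j => (hF j).last.mono (hs j),
    fun j k k' hkk' hk' => ?_, fun i j k hik hkj => ?_⟩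
  · obtain ⟨v, v', hv, hv', h⟩ := (hF j).mono k k' hkk' hk'
    exact ⟨v, v', hv.mono (hs j), hv'.mono (hs j), h⟩
  · rcases lt_or_ge i j with h | h
    · obtain ⟨v, hv, hvA⟩ := (hF j).holds i h k hik hkj
      exact ⟨v, hv.mono (hs j), hvA⟩
    · rcases h.lt_or_eq with h | rfl
      · exact absurd ((hik.trans hkj).trans_lt ((hF i).lt j h)) (lt_irrefl _)
      · obtain rfl := le_antisymm hik hkj
        exact ⟨_, (hF j).last.mono (hs j), hA j j le_rfl⟩

end Path

/-! ### Saturation for finite sets of the structure -/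

section Saturation

open Cardinal Ordinal Set

variable {V : Type u} [setLang.Structure V] [hV : Fact (IsModelZFCMinus V)]

/-- Fewer than `𝔭` definable conditions on the elements of a finite set of the structure can be
satisfied simultaneously as soon as any finitely many of them can. -/
theorem Cov.saturation (hp : ℵ₀ < pCard V) (hpt : pCard V < tCard V) {b : ℕ → OmegaHat V}
    (hb : StrictAnti b) {X : V} (hX : Cov X) {ι : Type u} (hι : #ι < pCard V) (D : ι → V → Prop)
    [∀ i, Def₁ (D i)] (hfin : ∀ F : Finset ι, ∃ x, Mem x X ∧ ∀ i ∈ F, D i x) :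
    ∃ x, Mem x X ∧ ∀ i, D i x := by
  obtain ⟨c, hc⟩ : ∃ c, #ι = c := ⟨_, rfl⟩
  induction c using WellFoundedLT.induction generalizing ι with
  | ind c ih =>
    rcases finite_or_infinite ι with hf | hinf
    · have := Fintype.ofFinite ι
      obtain ⟨x, hx, hD⟩ := hfin Finset.univ
      exact ⟨x, hx, fun i => hD i (Finset.mem_univ i)⟩
    have hcinf : ℵ₀ ≤ c := hc ▸ aleph0_le_mk ι
    let J := c.ord.ToType
    have hJ : #J = c := mk_ord_toType c
    obtain ⟨e⟩ : Nonempty (J ≃ ι) := Cardinal.eq.1 (hJ.trans hc.symm)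
    have hJlt : ∀ j : J, #(Iio j) < c := fun j => by
      simpa [hJ] using mk_Iio_lt j (by rw [hJ]; exact (type_toType _).symm)
    have hne : Nonempty J := mk_ne_zero_iff.1 (by rw [hJ]; exact (aleph0_pos.trans_le hcinf).ne')
    have hx : ∀ j : J, ∃ x, Mem x X ∧ ∀ i ≤ j, D (e i) x := by
      intro j
      have hlt : #(Iic j) < c := by
        rw [← Iio_insert]
        refine (mk_insert_le).trans_lt ?_
        exact add_lt_of_lt hcinf (hJlt j) (one_lt_aleph0.trans_le hcinf)
      obtain ⟨x, hx, hD⟩ := ih _ hlt (ι := Iic j) (hlt.trans (hc ▸ hι)) (fun i => D (e i.1))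
        (fun F => by
          obtain ⟨x, hx, hD⟩ := hfin (F.map ((Function.Embedding.subtype _).trans e.toEmbedding))
          exact ⟨x, hx, fun i hi => hD _ (Finset.mem_map_of_mem _ hi)⟩) rfl
      exact ⟨x, hx, fun i hi => hD ⟨i, hi⟩⟩
    choose x hxX hxD using hx
    obtain ⟨n₀, f, hn₀, hff, hfX⟩ := hX
    choose y hyn hyf using fun j => hfX (x j) (hxX j)
    let m₀ : OmegaHat V := ⟨n₀, hn₀⟩
    let z : J → OmegaHat V := fun j => ⟨y j, IsOm.of_mem hn₀ (hyn j)⟩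
    have hz : ∀ j, z j < m₀ := hyn
    obtain ⟨s, ν, -, hνn, -, -, hA⟩ := exists_path (V := V) (ι := J) (n := max m₀ (b 0)) (b := b)
      (fun _ _ => True) (fun i k => ∃ x, Mem x X ∧ PairMem f k x ∧ D (e i) x) z hp hpt
      (hJ.trans_lt ((hc ▸ hι).trans hpt)) (fun j => (hJlt j).trans (hc ▸ hι)) hb (le_max_right _ _)
      (fun j => (hz j).trans_le (le_max_left _ _)) (fun _ _ _ _ _ => trivial)
      (fun _ _ _ => trivial) (fun j i hij => ⟨x j, hxX j, hyf j, hxD j i hij⟩)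
    obtain ⟨k, -, hk, hkΦ⟩ := exists_overspill (V := V) hp.le (ι := J) (ι' := J)
      (hJ.trans_lt (hc ▸ hι)) (hJ.trans_lt (hc ▸ hι)) ν _ (fun j => (hνn j).le)
      (fun i k => (Mem (ν i).1 k ∨ (ν i).1 = k) →
        ∃ v, PairMem s.1 k v ∧ ∃ x, Mem x X ∧ PairMem f v x ∧ D (e i) x)
      (fun j i k hk hik => hA i j k (le_iff_mem.2 hik) hk)
    have hkA := fun i => hkΦ i k le_rfl (le_iff_mem.1 (hk i))
    obtain ⟨m, -, hm⟩ := s.2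
    obtain ⟨j₀⟩ := hne
    obtain ⟨v, hv, x₀, hx₀, hvx₀, -⟩ := hkA j₀
    refine ⟨x₀, hx₀, fun i => ?_⟩
    obtain ⟨v', hv', x₁, -, hvx₁, hD⟩ := hkA (e.symm i)
    obtain rfl := hm.unique hv hv'
    obtain rfl := hff _ _ _ hvx₀ hvx₁
    simpa using hD

end Saturation

/-! ### Colorings of well-orders -/

section Pigeonhole

open Cardinal Ordinal Set

/-- In a coloring of more than `#K` elements of a well-order with colors from `K`, some element is
preceded by `#K` elements of the same color. -/
theorem exists_many_predecessors {T K : Type u} [LinearOrder T] [WellFoundedLT T] [Infinite K]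
    (hKT : #K < #T) (c : T → K) : ∃ γ : T, #K ≤ #{β : T | β < γ ∧ c β = c γ} := by
  obtain ⟨a, ha⟩ := infinite_pigeonhole_card_lt c hKT ((aleph0_le_mk K).trans hKT.le)
  have hlt : (#K).ord < typeLT (c ⁻¹' {a}) := by
    rw [lt_iff_not_ge]
    intro hle
    have := card_le_card hle
    rw [card_type, card_ord] at this
    exact this.not_gt ha
  let γ : c ⁻¹' {a} := enum (α := c ⁻¹' {a}) (· < ·) ⟨_, hlt⟩
  have hγ : #{β : c ⁻¹' {a} | β < γ} = #K := by
    have := card_typein (α := c ⁻¹' {a}) (r := (· < ·)) γ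
    rw [typein_enum, card_ord] at this
    exact this.symm
  refine ⟨γ.1, hγ.symm.le.trans ?_⟩
  refine mk_le_of_injective (f := fun β => ⟨β.1.1, β.2, (β.1.2 : c β.1.1 = a).trans γ.2.symm⟩) ?_
  intro β β' h
  exact Subtype.ext (Subtype.ext (congrArg (fun x => x.1) h))

/-- The elements with at most `κ` predecessors form an initial segment; if it is proper, then the
least element outside has more than `κ` predecessors. -/
theorem lt_mk_small_initial {L : Type u} [LinearOrder L] [WellFoundedLT L] {κ : Cardinal.{u}}
    (h : κ < #L) : κ < #{j : L // #(Iio j) ≤ κ} := by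
  by_contra hle
  rw [not_lt] at hle
  obtain ⟨j, hj⟩ : ∃ j : L, ¬ #(Iio j) ≤ κ := by
    by_contra hall
    push Not at hall
    exact (h.trans_le (mk_le_of_injective
      (f := fun j : L => (⟨j, hall j⟩ : {j : L // #(Iio j) ≤ κ}))
      fun _ _ h => congrArg Subtype.val h)).not_ge hle
  induction j using WellFoundedLT.induction with
  | ind j ih =>
    refine hj (le_trans (mk_le_of_injective (f := fun i : Iio j =>
      (⟨i.1, not_not.1 fun hi => ih i.1 i.2 hi⟩ : {j : L // #(Iio j) ≤ κ})) ?_) hle)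
    exact fun _ _ h => Subtype.ext (congrArg (fun x => x.1) h)

end Pigeonhole

/-! ### Coloring by rows -/

section Rows

open Cardinal Ordinal Set

variable {V : Type u} [setLang.Structure V]

/-- `Bounded S w`: if `l` is the label of some `Y` in `S`, that is, if `(l, l)` belongs to `Y`, then
`w` bounds the values that the elements of `S` assign to `l`. -/
def Bounded (S w : V) : Prop :=
  ∀ Y Y', Mem Y S → Mem Y' S → ∀ l v, PairMem Y l l → PairMem Y' l v → v ≠ l → Mem v w

/-- `f` assigns to `k` the pair `(S, w)`. -/
def Codes (f k S w : V) : Prop := ∃ p, PairMem f k p ∧ IsOPair p S w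

instance defBounded {n : ℕ} (s t : (Fin n → V) → V) [Tm s] [Tm t] :
    Def (fun v => Bounded (s v) (t v)) := by
  unfold Bounded; infer_instance

instance defCodes {n : ℕ} (f s t r : (Fin n → V) → V) [Tm f] [Tm s] [Tm t] [Tm r] :
    Def (fun v => Codes (f v) (s v) (t v) (r v)) := by
  unfold Codes; infer_instance

variable [hV : Fact (IsModelZFCMinus V)]

theorem exists_of_finset (F : Finset V) : ∃ y : V, ∀ z, Mem z y ↔ z ∈ F := by
  classical
  induction F using Finset.induction with
  | empty =>
    obtain ⟨e, he⟩ := exists_isEmptySet (V := V)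
    exact ⟨e, fun z => by simp [he z]⟩
  | insert a F _ ih =>
    obtain ⟨y, hy⟩ := ih
    obtain ⟨x, hx⟩ := exists_insert y a
    exact ⟨x, fun z => by rw [hx, hy, Finset.mem_insert, or_comm]⟩

variable {L : Type u} [LinearOrder L] {e u : L → OmegaHat V}

/-- `IsRow e u γ Y`: the relation `Y` assigns to each `e β` with `β ≤ γ` the value `u β` and no
other value. It is defined only at numbers from `e γ` on, and its only label is `e γ`. -/
structure IsRow (e u : L → OmegaHat V) (γ : L) (Y : V) : Prop where
  not_lt : ∀ l v, PairMem Y l v → ¬ Mem l (e γ).1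
  label_unique : ∀ l, PairMem Y l l → l = (e γ).1
  value : ∀ β ≤ γ, PairMem Y (e β).1 (u β).1
  eq_value : ∀ β ≤ γ, ∀ v, PairMem Y (e β).1 v → v = (u β).1

/-- Rows exist because each condition on a row concerns one `β ≤ γ`, and a finite set of pairs meets
finitely many of them. -/
theorem exists_isRow (hp : ℵ₀ < pCard V) (hpt : pCard V < tCard V) {b : ℕ → OmegaHat V}
    (hb : StrictAnti b) (he : StrictAnti e) {γ : L} (hγ : #(Iic γ) < pCard V)
    (hu : ∀ β < γ, u β ≠ e β) {P Q : V} (hQ : Cov Q) (hPQ : ∀ y, IsSubset y P → Mem y Q)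
    (hP : ∀ β ≤ γ, Mem (opair (e β).1 (u β).1) P) :
    ∃ Y, Mem Y Q ∧ IsRow e u γ Y := by
  classical
  obtain ⟨Y, hYQ, hY⟩ := hQ.saturation hp hpt hb hγ
    (fun β Y => (∀ l v, PairMem Y l v → ¬ Mem l (e γ).1) ∧
      (∀ l, PairMem Y l l → l = (e γ).1) ∧ PairMem Y (e β.1).1 (u β.1).1 ∧
      ∀ v, PairMem Y (e β.1).1 v → v = (u β.1).1) (by
    intro F
    obtain ⟨Y, hY⟩ := exists_of_finset (F.image fun β : Iic γ => opair (e β.1).1 (u β.1).1)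
    have hmem : ∀ l v, PairMem Y l v ↔ ∃ β ∈ F, (e β.1).1 = l ∧ (u β.1).1 = v := by
      intro l v
      simp [pairMem_iff, hY, opair_inj]
    refine ⟨Y, hPQ Y fun z hz => ?_, fun β hβ => ⟨fun l v h => ?_, fun l h => ?_,
      (hmem _ _).2 ⟨β, hβ, rfl, rfl⟩, fun v h => ?_⟩⟩
    · obtain ⟨β, -, rfl⟩ := Finset.mem_image.1 ((hY z).1 hz)
      exact hP β.1 β.2
    · obtain ⟨α, -, rfl, -⟩ := (hmem _ _).1 h
      exact (he.antitone α.2).not_gt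
    · obtain ⟨α, -, rfl, h⟩ := (hmem _ _).1 h
      rcases (show α.1 ≤ γ from α.2).lt_or_eq with hlt | heq
      · exact absurd (Subtype.ext h) (hu α.1 hlt)
      · rw [heq]
    · obtain ⟨α, -, hα, rfl⟩ := (hmem _ _).1 h
      rw [he.injective (Subtype.ext hα)])
  have hγ' := hY ⟨γ, le_rfl⟩
  exact ⟨Y, hYQ, hγ'.1, hγ'.2.1, fun β hβ => (hY ⟨β, hβ⟩).2.2.1, fun β hβ => (hY ⟨β, hβ⟩).2.2.2⟩

/-- Fewer than `𝔭` rows belong to a set of the structure that is bounded by `w`, provided `w` lies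
above all values of the rows at earlier labels. -/
theorem exists_bounded (hp : ℵ₀ < pCard V) (hpt : pCard V < tCard V) {b : ℕ → OmegaHat V}
    (hb : StrictAnti b) (he : StrictAnti e) {Q R : V} (hR : Cov R)
    (hQR : ∀ y, IsSubset y Q → Mem y R) {ι : Type u} (hι : #ι < pCard V) (γ : ι → L)
    (U : ι → L → OmegaHat V) (hU : ∀ i, U i (γ i) = e (γ i)) (Y : ι → V)
    (hYQ : ∀ i, Mem (Y i) Q) (hY : ∀ i, IsRow e (U i) (γ i) (Y i)) (w : OmegaHat V)
    (hw : ∀ i, ∀ β < γ i, U i β < w) :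
    ∃ S, Mem S R ∧ Bounded S w.1 ∧ ∀ i, Mem (Y i) S := by
  classical
  have hbdd : ∀ S, (∀ z, Mem z S → ∃ i, Y i = z) → Bounded S w.1 := by
    intro S hS y y' hy hy' l v hl hv hvl
    obtain ⟨i, rfl⟩ := hS y hy
    obtain ⟨i', rfl⟩ := hS y' hy'
    obtain rfl := (hY i).label_unique l hl
    rcases lt_trichotomy (γ i) (γ i') with h | h | h
    · rw [(hY i').eq_value _ h.le v hv]
      exact hw i' _ h
    · refine absurd ?_ hvl
      rw [(hY i').eq_value _ h.le v hv, h, hU]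
    · exact absurd (he h) ((hY i').not_lt _ _ hv)
  rcases isEmpty_or_nonempty ι with hempty | hne
  · obtain ⟨E, hE⟩ := exists_isEmptySet (V := V)
    exact ⟨E, hQR E fun z hz => absurd hz (hE z), fun y _ hy => absurd hy (hE y), hempty.elim⟩
  obtain ⟨S, hSR, hS⟩ := hR.saturation hp hpt hb hι (fun i S => Bounded S w.1 ∧ Mem (Y i) S) (by
    intro F
    obtain ⟨S, hS⟩ := exists_of_finset (F.image Y)
    refine ⟨S, hQR S fun z hz => ?_, fun i hi => ⟨hbdd S fun z hz => ?_, ?_⟩⟩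
    · obtain ⟨i, -, rfl⟩ := Finset.mem_image.1 ((hS z).1 hz)
      exact hYQ i
    · obtain ⟨i, -, rfl⟩ := Finset.mem_image.1 ((hS z).1 hz)
      exact ⟨i, rfl⟩
    · exact (hS _).2 (Finset.mem_image_of_mem Y hi))
  exact ⟨S, hSR, (hS hne.some).1, fun i => (hS i).2⟩

end Rows

/-! ### Filling the gap -/

section Contradiction

open Cardinal Ordinal Set

variable {V : Type u} [setLang.Structure V]

/-- `Lighter f k k'`: the second coordinate of the pair coded by `k'` is at most that of the pair
coded by `k`. -/
def Lighter (f k k' : V) : Prop :=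
  ∃ S w S' w', Codes f k S w ∧ Codes f k' S' w' ∧ IsOm w ∧ IsOm w' ∧ (Mem w' w ∨ w' = w)

instance defLighter {n : ℕ} (f s t : (Fin n → V) → V) [Tm f] [Tm s] [Tm t] :
    Def (fun v => Lighter (f v) (s v) (t v)) := by
  unfold Lighter; infer_instance

theorem Codes.unique {f k S w S' w' : V} (hf : ∀ i x y, PairMem f i x → PairMem f i y → x = y)
    (h : Codes f k S w) (h' : Codes f k S' w') : S = S' ∧ w = w' := by
  obtain ⟨p, hp, hpS⟩ := h
  obtain ⟨p', hp', hpS'⟩ := h'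
  obtain rfl := hf _ _ _ hp hp'
  exact hpS.inj hpS'

variable [hV : Fact (IsModelZFCMinus V)]

theorem Lighter.trans {f k k' k'' : V} (hf : ∀ i x y, PairMem f i x → PairMem f i y → x = y)
    (h : Lighter f k k') (h' : Lighter f k' k'') : Lighter f k k'' := by
  obtain ⟨S, w, S', w', hS, hS', hw, hw', hle⟩ := h
  obtain ⟨T', v', T, v, hT', hT, hv', hv, hle'⟩ := h'
  obtain ⟨rfl, rfl⟩ := hS'.unique hf hT'
  let a : OmegaHat V := ⟨w, hw⟩
  let b : OmegaHat V := ⟨w', hw'⟩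
  let c : OmegaHat V := ⟨v, hv⟩
  have hab : b ≤ a := le_iff_mem.2 hle
  have hbc : c ≤ b := le_iff_mem.2 hle'
  exact ⟨S, w, T, v, hS, hT, hw, hv, le_iff_mem.1 (hbc.trans hab)⟩

theorem Lighter.le {f k k' S S' : V} {w w' : OmegaHat V}
    (hf : ∀ i x y, PairMem f i x → PairMem f i y → x = y) (h : Lighter f k k')
    (hk : Codes f k S w.1) (hk' : Codes f k' S' w'.1) : w' ≤ w := by
  obtain ⟨T, v, T', v', hT, hT', -, -, hle⟩ := h
  rw [le_iff_mem, (hk.unique hf hT).2, (hk'.unique hf hT').2]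
  exact hle

set_option synthInstance.maxHeartbeats 200000 in
set_option synthInstance.maxSize 1000 in
/-- An increasing sequence and a decreasing sequence above it, the latter of length `𝔭` and the
former shorter, do not form a cut. -/
theorem exists_between_of_lt_tCard {K L : Type u} [LinearOrder K] [WellFoundedLT K] [Infinite K]
    [LinearOrder L] [WellFoundedLT L] [NoMaxOrder L] (hpt : pCard V < tCard V) (hKL : #K < #L)
    (hL : #L = pCard V) (hKs : ∀ i : K, #(Iio i) < #K) (hLs : ∀ j : L, #(Iio j) < #L)
    {d : K → OmegaHat V} {e : L → OmegaHat V} (hd : StrictMono d) (he : StrictAnti e)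
    (hde : ∀ i j, d i < e j) : ∃ c, ∀ i j, d i < c ∧ c < e j := by
  classical
  by_contra hgap
  have hfill : ∀ c, (∀ j, c < e j) → ∃ i, c ≤ d i := by
    intro c hc
    by_contra! h
    exact hgap ⟨c, fun i j => ⟨h i, hc j⟩⟩
  have hp : ℵ₀ < pCard V := hL ▸ (aleph0_le_mk K).trans_lt hKL
  have hLne : Nonempty L := mk_ne_zero_iff.1 (by rw [hL]; exact (aleph0_pos.trans hp).ne')
  have hIic : ∀ j : L, #(Iic j) < pCard V := by
    intro j
    rw [← Iio_insert]
    exact mk_insert_le.trans_lt (add_lt_of_lt hp.le (hL ▸ hLs j) (one_lt_aleph0.trans hp))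
  obtain ⟨q, hq⟩ := Nat.exists_strictMono L
  have hb : StrictAnti (e ∘ q) := he.comp_strictMono hq
  -- All numbers in question lie below `N`.
  obtain ⟨l₀, hl₀⟩ : ∃ l₀ : L, ∀ j, l₀ ≤ j :=
    ⟨wellFounded_lt.min univ univ_nonempty, fun j => wellFounded_lt.min_le (mem_univ j)⟩
  set N := (e l₀).succ with hN
  have heN : ∀ j, e j < N := fun j => OmegaHat.lt_succ_iff.2 (he.antitone (hl₀ j))
  have hdN : ∀ i, d i < N := fun i => (hde i l₀).trans (heN l₀)
  -- The rows: below a label with at most `#K` predecessors, values do not repeat.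
  have hg : ∀ γ : L, ∃ g : L → K, #(Iio γ) ≤ #K → InjOn g (Iio γ) := by
    intro γ
    by_cases h : #(Iio γ) ≤ #K
    · obtain ⟨φ⟩ := Cardinal.le_def _ _ |>.1 h
      refine ⟨fun β => if hβ : β < γ then φ ⟨β, hβ⟩ else Classical.arbitrary K,
        fun _ β hβ β' hβ' hββ' => ?_⟩
      simp only [dif_pos (show β < γ from hβ), dif_pos (show β' < γ from hβ')] at hββ'
      exact congrArg (fun x => x.1) (φ.injective hββ')
    · exact ⟨fun _ => Classical.arbitrary K, fun h' => absurd h' h⟩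
  choose g hg using hg
  let U : L → L → OmegaHat V := fun γ β => if β < γ then d (g γ β) else e β
  have hU : ∀ γ, U γ γ = e γ := fun γ => if_neg (lt_irrefl γ)
  have hU' : ∀ γ, ∀ β < γ, U γ β = d (g γ β) := fun γ β h => if_pos h
  have hUN : ∀ γ β, U γ β < N := by
    intro γ β
    by_cases h : β < γ
    · rw [hU' γ β h]; exact hdN _
    · simp only [U, if_neg h]; exact heN _
  obtain ⟨P, hPc, hP⟩ := (IsOm.cov N.2).prod (IsOm.cov N.2)
  obtain ⟨Q, hQc, hQ⟩ := hPc.powerset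
  obtain ⟨R, hRc, hR⟩ := hQc.powerset
  obtain ⟨C, hCc, hC⟩ := hRc.prod (IsOm.cov N.2)
  -- `P` contains the rows' pairs, `Q` the rows, `R` the sets of rows, and `C` the weighted sets.
  choose Y hYQ hY using fun γ => exists_isRow (u := U γ) hp hpt hb he (hIic γ)
    (fun β hβ => by rw [hU' γ β hβ]; exact (hde _ _).ne) hQc hQ
    (fun β _ => hP _ _ (heN β) (hUN γ β))
  choose S hSR hSb hYS using fun j : L => exists_bounded (ι := Iic j) hp hpt hb he hRc hR (hIic j)
    (fun γ => γ.1) (fun γ => U γ.1) (fun γ => hU γ.1) (fun γ => Y γ.1) (fun γ => hYQ γ.1)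
    (fun γ => hY γ.1) (e j) (fun γ β hβ => by rw [hU' _ β hβ]; exact hde _ _)
  obtain ⟨m, f, hm, hf, hfC⟩ := hCc
  choose x hxm hxf using fun j => hfC _ (hC _ _ (hSR j) (heN j))
  have hcode : ∀ j, Codes f (x j) (S j) (e j).1 := fun j => ⟨_, hxf j, isOPair_opair _ _⟩
  let m' : OmegaHat V := ⟨m, hm⟩
  let z : L → OmegaHat V := fun j => ⟨x j, IsOm.of_mem hm (hxm j)⟩
  have hz : ∀ j, z j < m' := hxm
  obtain ⟨s, ν, hν, hνn, hsx, hmono, hA⟩ := exists_path (V := V) (n := max m' ((e ∘ q) 0))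
    (b := e ∘ q) (Lighter f)
    (fun i k => ∃ S w, Codes f k S w ∧ IsOm w ∧ Bounded S w ∧ Mem (Y i) S) z hp hpt (hL ▸ hpt)
    (fun j => hL ▸ hLs j) hb (le_max_right _ _) (fun j => (hz j).trans_le (le_max_left _ _))
    (fun _ _ _ => Lighter.trans hf)
    (fun i j hij => ⟨_, _, _, _, hcode i, hcode j, (e i).2, (e j).2,
      le_iff_mem.1 (he.antitone hij)⟩)
    (fun j i hij => ⟨_, _, hcode j, (e j).2, hSb j, hYS j ⟨i, hij⟩⟩)
  obtain ⟨dom, -, hs⟩ := s.2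
  -- The row `Y γ` survives beyond all `ν j`, up to some place of weight at most `d (c γ)`.
  have hsurv : ∀ γ : L, ∃ i : K, ∃ a : OmegaHat V,
      (∃ v S, ∃ w ≤ d i, PairMem s.1 a.1 v ∧ Codes f v S w.1) ∧
      ∀ k, ν γ ≤ k → k ≤ a → ∃ v, PairMem s.1 k.1 v ∧ ∃ S w, Codes f v S w ∧ IsOm w ∧
        Bounded S w ∧ Mem (Y γ) S := by
    intro γ
    have hΦ : ∀ j, ∀ k ≤ ν j, ((Mem (ν γ).1 k.1 ∨ (ν γ).1 = k.1) →
        ∃ v, PairMem s.1 k.1 v ∧ ∃ S w, Codes f v S w ∧ IsOm w ∧ Bounded S w ∧ Mem (Y γ) S) ∧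
        ∀ k', (Mem k' k.1 ∨ k' = k.1) →
          ∃ v v', PairMem s.1 k' v ∧ PairMem s.1 k.1 v' ∧ Lighter f v v' := by
      refine fun j k hk => ⟨fun h => hA γ j k (le_iff_mem.2 h) hk, fun k' hk' => ?_⟩
      have hk'o : IsOm k' := hk'.elim (IsOm.of_mem k.2) (fun h => h ▸ k.2)
      exact hmono j ⟨k', hk'o⟩ k (le_iff_mem.2 hk') hk
    obtain ⟨a, -, haΦ, hamax⟩ := exists_max_prefix (fun k => ((Mem (ν γ).1 k ∨ (ν γ).1 = k) →
        ∃ v, PairMem s.1 k v ∧ ∃ S w, Codes f v S w ∧ IsOm w ∧ Bounded S w ∧ Mem (Y γ) S) ∧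
        ∀ k', (Mem k' k ∨ k' = k) →
          ∃ v v', PairMem s.1 k' v ∧ PairMem s.1 k v' ∧ Lighter f v v') _ (hΦ l₀ ⊥ bot_le)
    have hνa : ∀ j, ν j ≤ a := fun j => hamax _ (hνn j).le (hΦ j)
    obtain ⟨v, hv, T, w, hw, hwo, -⟩ := (haΦ a le_rfl).1 (le_iff_mem.1 (hνa γ))
    let w' : OmegaHat V := ⟨w, hwo⟩
    obtain ⟨i, hi⟩ := hfill w' (by
      intro j
      obtain ⟨j', hj'⟩ := exists_gt j
      refine lt_of_le_of_lt ?_ (he hj')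
      obtain ⟨v₁, v₂, hv₁, hv₂, hlt⟩ := (haΦ a le_rfl).2 _ (le_iff_mem.1 (hνa j'))
      obtain rfl := hs.unique hv₁ (hsx j')
      obtain rfl := hs.unique hv₂ hv
      exact hlt.le hf (hcode j') hw)
    exact ⟨i, a, ⟨v, T, w', hi, hv, hw⟩, fun k hk hka => (haΦ k hka).1 (le_iff_mem.1 hk)⟩
  choose c a hac hasurv using hsurv
  obtain ⟨γ, hγ⟩ := exists_many_predecessors (lt_mk_small_initial hKL)
    fun γ : {j : L // #(Iio j) ≤ #K} => c γ.1
  -- The first place of weight at most `d (c γ)` lies beyond all `ν j`.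
  obtain ⟨k, ⟨v, T, w, hv, hw, hwo, hwd⟩, hkmin⟩ := exists_least
    (fun k => ∃ v T w, PairMem s.1 k v ∧ Codes f v T w ∧ IsOm w ∧
      (Mem w (d (c γ.1)).1 ∨ w = (d (c γ.1)).1)) (by
      obtain ⟨v, T, w, hw, hv, hvw⟩ := hac γ.1
      exact ⟨a γ.1, v, T, w.1, hv, hvw, w.2, le_iff_mem.1 hw⟩)
  let w' : OmegaHat V := ⟨w, hwo⟩
  have hwd' : w' ≤ d (c γ.1) := le_iff_mem.2 hwd
  have hνk : ∀ j, ν j ≤ k := by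
    intro j
    by_contra! hlt
    obtain ⟨v₁, v₂, hv₁, hv₂, hle⟩ := hmono j k _ hlt.le le_rfl
    obtain rfl := hs.unique hv₁ hv
    obtain rfl := hs.unique hv₂ (hsx j)
    exact ((hle.le (w := w') hf hw (hcode j)).trans hwd').not_gt (hde _ _)
  have hka : ∀ β : L, c β = c γ.1 → k ≤ a β := by
    intro β hβ
    obtain ⟨v, T, w, hw, hv, hvw⟩ := hac β
    exact hkmin _ ⟨v, T, w.1, hv, hvw, w.2, le_iff_mem.1 (hβ ▸ hw)⟩
  have hmem : ∀ β : L, c β = c γ.1 → Mem (Y β) T ∧ Bounded T w := by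
    intro β hβ
    obtain ⟨v', hv', T', w₁, hw₁, -, hbd, hYT⟩ := hasurv β k (hνk β) (hka β hβ)
    obtain rfl := hs.unique hv hv'
    obtain ⟨rfl, rfl⟩ := hw.unique hf hw₁
    exact ⟨hYT, hbd⟩
  have hlt : ∀ β < γ.1, c β = c γ.1 → g γ.1 β < c γ.1 := by
    intro β hβ hc
    have h := (hmem γ.1 rfl).2 _ _ (hmem β hc).1 (hmem γ.1 rfl).1 (e β).1 (U γ.1 β).1
      (by simpa [hU] using (hY β).value β le_rfl) ((hY γ.1).value β hβ.le)
      (fun h => (hde (g γ.1 β) β).ne (by rw [← hU' γ.1 β hβ]; exact Subtype.ext h))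
    rw [hU' γ.1 β hβ] at h
    have h' : d (g γ.1 β) < w' := h
    exact hd.lt_iff_lt.1 (h'.trans_le hwd')
  refine (hγ.trans (mk_le_of_injective
    (f := fun β => (⟨g γ.1 β.1.1, hlt β.1.1 β.2.1 β.2.2⟩ : Iio (c γ.1))) ?_)).not_gt (hKs (c γ.1))
  intro β β' h
  exact Subtype.ext (Subtype.ext (hg γ.1 γ.2 β.2.1 β'.2.1 (congrArg (fun x => x.1) h)))

end Contradiction

end SetModel

theorem mainTheorem6 {V : Type u} [SetModel.setLang.Structure V]
    (hV : SetModel.IsModelZFCMinus V) (hns : SetModel.IsOmegaNonstandard V)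
    (hpt : SetModel.pCard V < SetModel.tCard V)
    (κ : Cardinal.{u}) (hκ : κ.IsRegular) (hκp : κ < SetModel.pCard V) :
    (κ, SetModel.pCard V) ∉ SetModel.cutSpectrum (SetModel.OmegaHat V) := by
  rintro ⟨-, hreg, d, e, hpre, hgap⟩
  have : Fact (SetModel.IsModelZFCMinus V) := ⟨hV⟩
  simp only at hreg d e hpre hgap
  have hlimK : ∀ i : Set.Iio κ.ord, ∃ i', i < i' := fun i =>
    ⟨⟨_, (Cardinal.isSuccLimit_ord hκ.aleph0_le).succ_lt i.2⟩, Order.lt_succ i.1⟩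
  have hlimL : ∀ j : Set.Iio (SetModel.pCard V).ord, ∃ j', j < j' := fun j =>
    ⟨⟨_, (Cardinal.isSuccLimit_ord hreg.aleph0_le).succ_lt j.2⟩, Order.lt_succ j.1⟩
  have hj₀ : Nonempty (Set.Iio (SetModel.pCard V).ord) := ⟨⟨0, hreg.ord_pos⟩⟩
  have hi₀ : Nonempty (Set.Iio κ.ord) := ⟨⟨0, hκ.ord_pos⟩⟩
  have hd : StrictMono d := by
    intro i i' hi
    obtain ⟨j⟩ := hj₀
    obtain ⟨j', hj⟩ := hlimL j
    exact (hpre i i' hi j j' hj).1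
  have he : StrictAnti e := by
    intro j j' hj
    obtain ⟨i⟩ := hi₀
    obtain ⟨i', hi⟩ := hlimK i
    exact (hpre i i' hi j j' hj).2.2
  have hde : ∀ i j, d i < e j := by
    intro i j
    obtain ⟨i', hi⟩ := hlimK i
    obtain ⟨j', hj⟩ := hlimL j
    exact (hd hi).trans ((hpre i i' hi j j' hj).2.1.trans (he hj))
  have : Infinite κ.ord.ToType := by
    rw [Cardinal.infinite_iff, Cardinal.mk_ord_toType]
    exact hκ.aleph0_le
  let φ := Ordinal.ToType.mk (o := κ.ord)
  let ψ := Ordinal.ToType.mk (o := (SetModel.pCard V).ord)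
  have : NoMaxOrder (SetModel.pCard V).ord.ToType := ⟨fun j => by
    obtain ⟨j', hj⟩ := hlimL (ψ.symm j)
    exact ⟨ψ j', by simpa using ψ.strictMono hj⟩⟩
  obtain ⟨c, hc⟩ := SetModel.exists_between_of_lt_tCard (V := V) (K := κ.ord.ToType)
    (L := (SetModel.pCard V).ord.ToType) hpt
    (by simpa using hκp) (by simp)
    (fun i => Cardinal.mk_Iio_lt i (by simp))
    (fun j => Cardinal.mk_Iio_lt j (by simp))
    (d := d ∘ φ.symm) (e := e ∘ ψ.symm) (hd.comp φ.symm.strictMono)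
    (he.comp_strictMono ψ.symm.strictMono) (fun i j => hde _ _)
  exact hgap ⟨c, fun i j => by simpa using hc (φ i) (ψ j)⟩
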